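/- Let $(Z,dz)$ be a measurable space with a $\sigma$-finite reference measure, let $\Omega\subseteq\mathbb{R}^d$ be open, and let $q(\cdot|\lambda)$, $\lambda\in\Omega$, be strictly positive, jointly measurable probability densities on $Z$ such that $\lambda\mapsto q(z|\lambda)$ is $C^1$ on $\Omega$ for every $z$. Let $f:Z\to\mathbb{R}$ be measurable with $\int e^{-f(z)}\,dz<\infty$ (in variational inference $f=-\log\pi(D,\cdot)$). Assume that for every compact $K\subset\Omega$ there is an integrable $b_K:Z\to\mathbb{R}$ with $$\bigl(q(z|\lambda)+\|\nabla_\lambda q(z|\lambda)\|\bigr)\bigl(1+|f(z)|+|\log q(z|\lambda')|+\log^+\|\nabla_\lambda q(z|\lambda)\|\bigr)\le b_K(z)\qquad(\lambda,\lambda'\in K,\ z\in Z).$$ For a probability measure $\rho$ on $\Omega$ put $q_\rho(z)=\int q(z|\lambda)\,d\rho(\lambda)$ and $$\mathcal{L}(\rho)=\mathbb{E}_{\lambda\sim\rho}\,\mathbb{E}_{z\sim q(\cdot|\lambda)}\bigl[f(z)+\log q_\rho(z)\bigr]\in(-\infty,+\infty],$$ and let $\mathcal{P}(\Omega)$ be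 the set of those $\rho$ with $\mathcal{L}(\rho)<\infty$. A first variation of $\mathcal{L}$ at $\rho\in\mathcal{P}(\Omega)$ is a $\rho$-integrable function $\delta\mathcal{L}(\rho)$ such that, for every probability measure $\sigma$ with compact support in $\Omega$, $\delta\mathcal{L}(\rho)$ is $\sigma$-integrable and $\lim_{\varepsilon\downarrow0}\varepsilon^{-1}\bigl[\mathcal{L}(\rho+\varepsilon(\sigma-\rho))-\mathcal{L}(\rho)\bigr]=\int\delta\mathcal{L}(\rho)\,d(\sigma-\rho)$. Let $C$ be a continuous field of symmetric positive-definite $d\times d$ matrices on $\Omega$, and let $(\lambda_t)_{t\ge0}$, with laws $(\rho_t)_{t\ge 0}$, be a preconditioned Wasserstein gradient flow of $\mathcal{L}$: $\lambda_t$ is a random element of $\Omega$ with law $\rho_t\in\mathcal{P}(\Omega)$, $\mathcal{L}$ has a differentiable first variation at each $\rho_t$, and almost surely, for all $t\ge0$, $$\lambda_t\in\Omega,\qquad\frac{d\lambda_t}{dt}=C(\lambda_t)\,v_t(\lambda_t),\qquad v_t=-\nabla\,\delta\mathcal{L}(\rho_t),$$ so that $\partial_t\rho_t+\operatorname{div}(\rho_tCv_t)=0$.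 Assume that for every $T>0$ $$\int_0^T\!\int_\Omega\int_Z\bigl|\langle\nabla_\lambda q(z|\lambda),\,C(\lambda)v_t(\lambda)\rangle\bigr|\,dz\,d\rho_t(\lambda)\,dt<\infty .$$ Write $\langle v_s,Cv_s\rangle_{L^2(\rho_s)}=\int\langle v_s(\lambda),C(\lambda)v_s(\lambda)\rangle\,d\rho_s(\lambda)\in[0,\infty]$. Then $\inf_{\rho\in\mathcal{P}(\Omega)}\mathcal{L}(\rho)>-\infty$, and for every $t>0$ the minimum of $\langle v_s,Cv_s\rangle_{L^2(\rho_s)}$ over $s\in[0,t]$ is attained and $$\min_{0\le s\le t}\langle v_s,Cv_s\rangle_{L^2(\rho_s)}\le\frac1t\int_0^t\langle v_s,Cv_s\rangle_{L^2(\rho_s)}\,ds\le\frac{\mathcal{L}(\rho_0)-\inf_{\rho\in\mathcal{P}(\Omega)}\mathcal{L}(\rho)}{t}.$$ In particular $\min_{0\le s\le t}\langle v_s,Cv_s\rangle_{L^2(\rho_s)}\to0$ as $t\to\infty$, at rate $O(1/t)$. -/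

import Mathlib

open MeasureTheory Filter Topology Set

noncomputable section

/-- The parameter space `ℝ^d` with its Euclidean norm. -/
abbrev Param (d : ℕ) : Type := EuclideanSpace ℝ (Fin d)

variable {d : ℕ} {Z : Type*} [MeasurableSpace Z]

/-- The mixture density `q_ρ(z) = ∫ q(z|l) dρ(l)`; here `q z l` stands for `q(z|l)`. -/
def mixtureDensity (q : Z → Param d → ℝ) (ρ : Measure (Param d)) (z : Z) : ℝ :=
  ∫ l, q z l ∂ρ

/-- The negated ELBO `L(ρ) = E_{l ∼ ρ} E_{z ∼ q(·|l)} [f(z) + log q_ρ(z)]`, the densities being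
taken with respect to `ν`. It is meaningful on `finiteLaws`. -/
def negELBO (ν : Measure Z) (q : Z → Param d → ℝ) (f : Z → ℝ) (ρ : Measure (Param d)) : ℝ :=
  ∫ l, ∫ z, q z l * (f z + Real.log (mixtureDensity q ρ z)) ∂ν ∂ρ

/-- The probability measures on `Ω` whose negated ELBO is finite. (As soon as `exp (-f)` is
integrable, the negative part of the integrand is integrable, so that the negated ELBO of every
other probability measure on `Ω` is `+∞`.) -/
def finiteLaws (Ω : Set (Param d)) (ν : Measure Z) (q : Z → Param d → ℝ) (f : Z → ℝ) :
    Set (Measure (Param d)) :=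
  {ρ | IsProbabilityMeasure ρ ∧ ρ Ωᶜ = 0 ∧
    Integrable (fun p : Param d × Z =>
      q p.2 p.1 * (f p.2 + Real.log (mixtureDensity q ρ p.2))) (ρ.prod ν)}

/-- `δ` is a first variation of the negated ELBO at `ρ`: its integral against `σ - ρ` is the
one-sided derivative of `L` at `ρ` in the direction `σ - ρ`, for every probability measure `σ`
with compact support in `Ω`. It is determined on `Ω` up to an additive constant. -/
def IsFirstVariation (Ω : Set (Param d)) (ν : Measure Z) (q : Z → Param d → ℝ) (f : Z → ℝ)
    (ρ : Measure (Param d)) (δ : Param d → ℝ) : Prop :=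
  ρ ∈ finiteLaws Ω ν q f ∧ Integrable δ ρ ∧
    ∀ (σ : Measure (Param d)) (K : Set (Param d)), IsProbabilityMeasure σ → IsCompact K → K ⊆ Ω →
      σ Kᶜ = 0 →
      Integrable δ σ ∧
        Tendsto (fun ε : ℝ =>
            (negELBO ν q f (ENNReal.ofReal (1 - ε) • ρ + ENNReal.ofReal ε • σ)
              - negELBO ν q f ρ) / ε)
          (𝓝[>] 0) (𝓝 ((∫ l, δ l ∂σ) - ∫ l, δ l ∂ρ))

/-- Regularity of the variational family `q(z|l)`, `l ∈ Ω`, and of `f = -log π(D, ·)`. -/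
structure IsRegularModel (Ω : Set (Param d)) (ν : Measure Z) (q : Z → Param d → ℝ)
    (f : Z → ℝ) : Prop where
  isOpen : IsOpen Ω
  measurable_q : Measurable (fun p : Z × Param d => q p.1 p.2)
  measurable_f : Measurable f
  pos : ∀ z, ∀ l ∈ Ω, 0 < q z l
  integral_eq_one : ∀ l ∈ Ω, ∫ z, q z l ∂ν = 1
  contDiffOn : ∀ z, ContDiffOn ℝ 1 (q z) Ω
  /-- The evidence `π(D) = ∫ π(D, z) dz` is finite. -/
  integrable_evidence : Integrable (fun z => Real.exp (-f z)) ν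
  /-- Local domination, for differentiation under the integral sign. -/
  dominated : ∀ K : Set (Param d), IsCompact K → K ⊆ Ω → ∃ b : Z → ℝ, Integrable b ν ∧
    ∀ z, ∀ l ∈ K, ∀ l' ∈ K,
      (q z l + ‖gradient (q z) l‖) *
        (1 + |f z| + |Real.log (q z l')| + Real.posLog ‖gradient (q z) l‖) ≤ b z

/-- The preconditioned Wasserstein gradient flow of the negated ELBO on `Ω`: the random particle
`Λ t` moves in `Ω` along `dΛ/dt = C(Λ) v_t(Λ)`, where `ρ t` is the law of `Λ t` and
`v_t = -∇ δL(ρ t)`. -/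
structure IsPreconditionedFlow {Ξ : Type*} [MeasurableSpace Ξ]
    (Ω : Set (Param d)) (ν : Measure Z) (q : Z → Param d → ℝ) (f : Z → ℝ)
    (C : Param d → Matrix (Fin d) (Fin d) ℝ) (P : Measure Ξ) (Λ : ℝ → Ξ → Param d)
    (ρ : ℝ → Measure (Param d)) (v : ℝ → Param d → Param d) : Prop where
  measurable : ∀ t, 0 ≤ t → Measurable (Λ t)
  mem : ∀ᵐ ξ ∂P, ∀ t, 0 ≤ t → Λ t ξ ∈ Ω
  law : ∀ t, 0 ≤ t → ρ t = P.map (Λ t)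
  velocity : ∀ t, 0 ≤ t → ∃ δ : Param d → ℝ, IsFirstVariation Ω ν q f (ρ t) δ ∧
    ∀ l ∈ Ω, HasGradientAt δ (-(v t l)) l
  ode : ∀ᵐ ξ ∂P, ∀ t, 0 ≤ t →
    HasDerivWithinAt (fun s => Λ s ξ)
      (Matrix.toEuclideanLin (C (Λ t ξ)) (v t (Λ t ξ))) (Ici 0) t

/-- `⟨u, C u⟩_{L²(ρ)} = ∫ ⟨u(l), C(l) u(l)⟩ dρ(l)`, for positive-definite `C` an integral of a
nonnegative function, with value `∞` where it diverges. -/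
def weightedSqNorm (C : Param d → Matrix (Fin d) (Fin d) ℝ) (ρ : Measure (Param d))
    (u : Param d → Param d) : ENNReal :=
  ∫⁻ l, ENNReal.ofReal (inner ℝ (u l) (Matrix.toEuclideanLin (C l) (u l))) ∂ρ

end

/-! The core is the energy identity `lintegral_dissipation`: over `[0, T]` the integral of `⟨v, C
v⟩` equals `L(ρ_0) - L(ρ_T)`. A minimum is at most a mean, and Gibbs' inequality bounds `L` below,
so the rest follows; attainment holds because the dissipation is lower semicontinuous in time by
Fatou.

The velocity is first made explicit. Testing the first variation against Dirac masses gives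
`δL(ρ)(l) = ∫ q(z|l) (f + log q_ρ) dz` up to a constant (`firstVariation_eq`), whence `v = -∫ (f +
log q_ρ) ∇q dz` (`gradient_firstVariation_eq`).

The identity is then proved path by path. For fixed `ξ` and almost every `z`, the product `q(z|X_s)
(f + log q_{ρ_s})` is integrated by parts in `s`. The derivative of the first factor, integrated
over `z`, produces `-⟨v, C v⟩` at the particle. The derivative of the logarithm produces the
exchange term `q(z|X_s) ∂_s q_{ρ_s} / q_{ρ_s}`, whose mean over `ξ` is `∂_s q_{ρ_s}`; its integral
over `z` and `s` vanishes because every `q_ρ` has mass one.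

The order of integration matters: the rate of `q` is jointly integrable, but its product with the
unbounded potential is controlled only along a single path, whose image over `[0, T]` is compact.
The exchange term is jointly integrable because `q_{ρ_s}` cancels on averaging. Integrability of the
dissipation in `ξ` is then read off from the balance, and its sign lets Tonelli exchange the
integrals. -/

noncomputable section

/-! ### Domination and measurability for the variational family. -/

variable {d : ℕ} {Z : Type*} [MeasurableSpace Z]

/-- Where `log u` is negative, `c * m ≤ u` controls it by `log m` and `log c`. Where it is positive,
`log (u / a) ≤ u / a - 1` gives `a log u ≤ a log⁺ a + u`. Used with `a` equal to `q` or `‖∇q‖` and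
`u = q_ρ`, this needs no upper bound on `q_ρ` beyond its integrability. -/
theorem mul_abs_add_log_le {a c m u b φ : ℝ} (ha : 0 ≤ a) (hc : 0 < c) (hm : 0 < m)
    (hu : c * m ≤ u) (h1 : a * (1 + |φ| + |Real.log m|) ≤ b)
    (h2 : a * (1 + |φ| + Real.posLog a) ≤ b) :
    a * |φ + Real.log u| ≤ (1 + |Real.log c|) * b + u := by
  have hu0 : 0 < u := (mul_pos hc hm).trans_le hu
  have hab : a ≤ b := by
    have : 0 ≤ a * (|φ| + |Real.log m|) := by positivity
    nlinarith
  have hkey : a * |Real.log u| ≤ a * |Real.log m| + a * |Real.log c| ∨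
      a * |Real.log u| ≤ a * Real.posLog a + u := by
    rcases le_total (Real.log u) 0 with h | h
    · left
      rw [← mul_add]
      refine mul_le_mul_of_nonneg_left ?_ ha
      have := Real.log_le_log (mul_pos hc hm) hu
      rw [Real.log_mul hc.ne' hm.ne'] at this
      rw [abs_of_nonpos h]
      linarith [neg_abs_le (Real.log m), neg_abs_le (Real.log c)]
    · right
      rw [abs_of_nonneg h]
      rcases le_total a 1 with ha1 | ha1
      · have h3 : Real.log u ≤ u := (Real.log_le_sub_one_of_pos hu0).trans (by linarith)
        have h4 : 0 ≤ a * Real.posLog a := mul_nonneg ha Real.posLog_nonneg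
        nlinarith
      · have ha0 : 0 < a := by linarith
        rw [Real.posLog_eq_log (by rwa [abs_of_pos ha0])]
        have h3 := Real.log_le_sub_one_of_pos (div_pos hu0 ha0)
        rw [Real.log_div hu0.ne' ha0.ne'] at h3
        have h4 := mul_le_mul_of_nonneg_left h3 ha
        have h5 : a * (u / a) = u := by field_simp
        nlinarith
  have h3 : a * |φ + Real.log u| ≤ a * |φ| + a * |Real.log u| := by
    rw [← mul_add]; exact mul_le_mul_of_nonneg_left (abs_add_le _ _) ha
  have h4 := mul_le_mul_of_nonneg_right hab (abs_nonneg (Real.log c))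
  have h5 : 0 ≤ |Real.log c| * b := mul_nonneg (abs_nonneg _) (ha.trans hab)
  rcases hkey with h | h <;> nlinarith

namespace IsRegularModel

variable {Ω : Set (Param d)} {ν : Measure Z} {q : Z → Param d → ℝ} {f : Z → ℝ}

theorem hasGradientAt (hM : IsRegularModel Ω ν q f) (z : Z) {l : Param d} (hl : l ∈ Ω) :
    HasGradientAt (q z) (gradient (q z) l) l :=
  (((hM.contDiffOn z).differentiableOn one_ne_zero).differentiableAt
    (hM.isOpen.mem_nhds hl)).hasGradientAt

theorem continuousOn_gradient (hM : IsRegularModel Ω ν q f) (z : Z) :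
    ContinuousOn (gradient (q z)) Ω := by
  have := (hM.contDiffOn z).continuousOn_fderiv_of_isOpen hM.isOpen le_rfl
  exact (InnerProductSpace.toDual ℝ (Param d)).symm.continuous.comp_continuousOn this

theorem continuousOn (hM : IsRegularModel Ω ν q f) (z : Z) : ContinuousOn (q z) Ω :=
  (hM.contDiffOn z).continuousOn

/-- The gradient of the density in the parameter, extended by zero off `Ω`, is jointly
measurable. -/
theorem measurable_indicator_gradient (hM : IsRegularModel Ω ν q f) :
    Measurable (fun p : Z × Param d => Ω.indicator (gradient (q p.1)) p.2) := by
  have hΩ : MeasurableSet {p : Z × Param d | p.2 ∈ Ω} := measurable_snd hM.isOpen.measurableSet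
  have hcoord : ∀ i : Fin d, Measurable
      (fun p : Z × Param d => (Ω.indicator (gradient (q p.1)) p.2) i) := by
    intro i
    let e : Param d := EuclideanSpace.single i (1 : ℝ)
    -- Difference quotients with step `1 / (n + 1)`. The shifted point may leave `Ω`, which is
    -- harmless: `q` is measurable everywhere, and only the limit at points of the open set `Ω`
    -- matters.
    let F : ℕ → Z × Param d → ℝ := fun n p =>
      {p : Z × Param d | p.2 ∈ Ω}.indicator
        (fun p => ((n : ℝ) + 1) * (q p.1 (p.2 + ((n : ℝ) + 1)⁻¹ • e) - q p.1 p.2)) p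
    refine measurable_of_tendsto_metrizable (f := F) (fun n => ?_) ?_
    · refine Measurable.indicator ?_ hΩ
      refine measurable_const.mul (Measurable.sub ?_ hM.measurable_q)
      exact hM.measurable_q.comp (measurable_fst.prodMk (measurable_snd.add_const _))
    · rw [tendsto_pi_nhds]
      rintro ⟨z, l⟩
      by_cases hl : l ∈ Ω
      · have hd := (hM.hasGradientAt z hl).hasFDerivAt.hasLineDerivAt e
        have hd' := hd.tendsto_slope_zero_right
        have hn : Tendsto (fun n : ℕ => ((n : ℝ) + 1)⁻¹) atTop (𝓝[>] 0) := by
          refine tendsto_nhdsWithin_iff.2 ⟨?_, Eventually.of_forall fun n => ?_⟩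
          · simpa using tendsto_one_div_add_atTop_nhds_zero_nat (𝕜 := ℝ)
          · simp only [mem_Ioi]; positivity
        have := hd'.comp hn
        simp only [F, indicator, hl, if_true, mem_ofPred_eq]
        convert this using 2 with n
        · simp
        · rw [InnerProductSpace.toDual_apply_apply, EuclideanSpace.inner_single_right]; simp
      · simp [F, hl]
  have h : Measurable (fun p : Z × Param d =>
      (MeasurableEquiv.toLp 2 (Fin d → ℝ))
        (fun i => (Ω.indicator (gradient (q p.1)) p.2) i)) :=
    (MeasurableEquiv.toLp 2 (Fin d → ℝ)).measurable.comp (measurable_pi_lambda _ hcoord)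
  exact h

theorem measurable_gradient (hM : IsRegularModel Ω ν q f) {l : Param d} (hl : l ∈ Ω) :
    Measurable (fun z => gradient (q z) l) := by
  have := hM.measurable_indicator_gradient.comp (measurable_id.prodMk (measurable_const (a := l)))
  simpa [Function.comp_def, hl] using this

theorem measurable_left (hM : IsRegularModel Ω ν q f) (l : Param d) :
    Measurable (fun z => q z l) :=
  hM.measurable_q.comp (measurable_id.prodMk measurable_const)

theorem measurable_right (hM : IsRegularModel Ω ν q f) (z : Z) : Measurable (q z) :=
  hM.measurable_q.comp (measurable_const.prodMk measurable_id)

theorem integrable_density (hM : IsRegularModel Ω ν q f) {l : Param d} (hl : l ∈ Ω) :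
    Integrable (fun z => q z l) ν :=
  Integrable.of_integral_ne_zero (by rw [hM.integral_eq_one l hl]; exact one_ne_zero)

section Mixture

variable [SigmaFinite ν] {ρ : Measure (Param d)} [IsProbabilityMeasure ρ]

theorem integrable_prod (hM : IsRegularModel Ω ν q f) (hρ : ρ Ωᶜ = 0) :
    Integrable (fun p : Param d × Z => q p.2 p.1) (ρ.prod ν) := by
  have hae : ∀ᵐ l ∂ρ, l ∈ Ω := mem_ae_iff.2 hρ
  have hm : Measurable (fun p : Param d × Z => q p.2 p.1) := hM.measurable_q.comp measurable_swap
  refine (integrable_prod_iff hm.aestronglyMeasurable).2 ⟨?_, ?_⟩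
  · filter_upwards [hae] with l hl using hM.integrable_density hl
  · refine (integrable_const (1 : ℝ)).congr ?_
    filter_upwards [hae] with l hl
    rw [← hM.integral_eq_one l hl]
    exact integral_congr_ae (ae_of_all _ fun z => by simp [abs_of_pos (hM.pos z l hl)])

theorem ae_integrable (hM : IsRegularModel Ω ν q f) (hρ : ρ Ωᶜ = 0) :
    ∀ᵐ z ∂ν, Integrable (q z) ρ :=
  (hM.integrable_prod hρ).prod_left_ae

omit [SigmaFinite ν] in
theorem measurable_mixtureDensity (hM : IsRegularModel Ω ν q f) :
    Measurable (mixtureDensity q ρ) := by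
  have : StronglyMeasurable (fun z => ∫ l, q z l ∂ρ) :=
    hM.measurable_q.stronglyMeasurable.integral_prod_right
  exact this.measurable

theorem integrable_mixtureDensity (hM : IsRegularModel Ω ν q f) (hρ : ρ Ωᶜ = 0) :
    Integrable (mixtureDensity q ρ) ν :=
  (hM.integrable_prod hρ).integral_prod_right

theorem integral_mixtureDensity (hM : IsRegularModel Ω ν q f) (hρ : ρ Ωᶜ = 0) :
    ∫ z, mixtureDensity q ρ z ∂ν = 1 := by
  have hae : ∀ᵐ l ∂ρ, l ∈ Ω := mem_ae_iff.2 hρ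
  have h := integral_integral_swap (f := fun l z => q z l) (hM.integrable_prod hρ)
  have h2 : ∫ l, ∫ z, q z l ∂ν ∂ρ = ∫ l, (1 : ℝ) ∂ρ :=
    integral_congr_ae (by filter_upwards [hae] with l hl using hM.integral_eq_one l hl)
  simp only [mixtureDensity]
  rw [← h, h2]; simp

omit [SigmaFinite ν] in
theorem mixtureDensity_pos (hM : IsRegularModel Ω ν q f) (hρ : ρ Ωᶜ = 0) {z : Z}
    (hz : Integrable (q z) ρ) : 0 < mixtureDensity q ρ z := by
  have hae : ∀ᵐ l ∂ρ, l ∈ Ω := mem_ae_iff.2 hρ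
  refine (integral_pos_iff_support_of_nonneg_ae ?_ hz).2 ?_
  · filter_upwards [hae] with l hl using (hM.pos z l hl).le
  · refine pos_iff_ne_zero.2 fun h0 => ?_
    have h1 : ∀ᵐ l ∂ρ, q z l = 0 := by
      rw [ae_iff]; exact h0
    obtain ⟨l, hl, hl'⟩ := (hae.and h1).exists
    exact (hM.pos z l hl).ne' hl'

omit [SigmaFinite ν] in
-- The witness minimises `q z` over `K`, so it depends on `z`. This is why the domination hypothesis
-- has a second parameter `λ'` inside the logarithm.
theorem exists_mul_le_mixtureDensity (hM : IsRegularModel Ω ν q f) (hρ : ρ Ωᶜ = 0)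
    {K : Set (Param d)} (hK : IsCompact K) (hKΩ : K ⊆ Ω) {c : ℝ} (hc : 0 < c)
    (hcK : c ≤ ρ.real K) {z : Z} (hz : Integrable (q z) ρ) :
    ∃ l ∈ K, c * q z l ≤ mixtureDensity q ρ z := by
  have hae : ∀ᵐ l ∂ρ, l ∈ Ω := mem_ae_iff.2 hρ
  have hne : K.Nonempty := by
    rw [nonempty_iff_ne_empty]; rintro rfl
    simp at hcK; linarith
  obtain ⟨l, hl, hmin⟩ := hK.exists_isMinOn hne ((hM.continuousOn z).mono hKΩ)
  refine ⟨l, hl, ?_⟩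
  have h0 := (hM.pos z l (hKΩ hl)).le
  calc c * q z l ≤ ρ.real K * q z l := mul_le_mul_of_nonneg_right hcK h0
    _ = ∫ _ in K, q z l ∂ρ := by simp
    _ ≤ ∫ l' in K, q z l' ∂ρ := by
        refine setIntegral_mono_on (integrable_const _) hz.integrableOn hK.measurableSet ?_
        intro l' hl'; exact hmin hl'
    _ ≤ ∫ l', q z l' ∂ρ := by
        refine setIntegral_le_integral hz ?_
        filter_upwards [hae] with l hl using (hM.pos z l hl).le

end Mixture

/-- Domination of `q (f + log q_ρ)` and of `∇q (f + log q_ρ)` on compact sets, uniformly over the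
mixing measures that give a compact set a mass bounded below. -/
theorem exists_bound (hM : IsRegularModel Ω ν q f) {K : Set (Param d)} (hK : IsCompact K)
    (hKΩ : K ⊆ Ω) : ∃ b : Z → ℝ, Integrable b ν ∧
      (∀ z, ∀ l ∈ K, q z l * (|f z| + |Real.log (q z l)|) ≤ b z) ∧
      ∀ (ρ : Measure (Param d)) [IsProbabilityMeasure ρ], ρ Ωᶜ = 0 → ∀ c : ℝ, 0 < c →
        c ≤ ρ.real K → ∀ z, Integrable (q z) ρ → ∀ l ∈ K,
          q z l * |f z + Real.log (mixtureDensity q ρ z)| ≤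
            (1 + |Real.log c|) * b z + mixtureDensity q ρ z ∧
          ‖gradient (q z) l‖ * |f z + Real.log (mixtureDensity q ρ z)| ≤
            (1 + |Real.log c|) * b z + mixtureDensity q ρ z := by
  obtain ⟨b, hb, hdom⟩ := hM.dominated K hK hKΩ
  refine ⟨b, hb, ?_, ?_⟩
  · intro z l hl
    have h := hdom z l hl l hl
    have h0 := hM.pos z l (hKΩ hl)
    have : 0 ≤ Real.posLog ‖gradient (q z) l‖ := Real.posLog_nonneg
    refine le_trans ?_ h
    have hg := norm_nonneg (gradient (q z) l)
    have : 0 ≤ |f z| := abs_nonneg _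
    have : 0 ≤ |Real.log (q z l)| := abs_nonneg _
    apply mul_le_mul <;> first | positivity | linarith
  · intro ρ _ hρ c hc hcK z hz l hl
    obtain ⟨l', hl', hle⟩ := hM.exists_mul_le_mixtureDensity hρ hK hKΩ hc hcK hz
    have hm := hM.pos z l' (hKΩ hl')
    have h0 := hM.pos z l (hKΩ hl)
    have hg := norm_nonneg (gradient (q z) l)
    have hp : 0 ≤ Real.posLog ‖gradient (q z) l‖ := Real.posLog_nonneg
    have hql : Real.posLog (q z l) ≤ |Real.log (q z l)| := by
      simp only [Real.posLog]
      exact max_le (abs_nonneg _) (le_abs_self _)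
    have hd1 := hdom z l hl l' hl'
    have hd2 := hdom z l hl l hl
    constructor
    · refine mul_abs_add_log_le h0.le hc hm hle ?_ ?_
      · refine le_trans ?_ hd1
        have : 0 ≤ |f z| := abs_nonneg _
        have : 0 ≤ |Real.log (q z l')| := abs_nonneg _
        apply mul_le_mul <;> first | positivity | linarith
      · refine le_trans ?_ hd2
        have : 0 ≤ |f z| := abs_nonneg _
        apply mul_le_mul <;> first | positivity | linarith [Real.posLog_nonneg (x := q z l)]
    · refine mul_abs_add_log_le hg hc hm hle ?_ ?_
      · refine le_trans ?_ hd1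
        have : 0 ≤ |f z| := abs_nonneg _
        have : 0 ≤ |Real.log (q z l')| := abs_nonneg _
        apply mul_le_mul <;> first | positivity | linarith
      · refine le_trans ?_ hd1
        have : 0 ≤ |f z| := abs_nonneg _
        have : 0 ≤ |Real.log (q z l')| := abs_nonneg _
        apply mul_le_mul <;> first | positivity | linarith

end IsRegularModel

/-! ### The first variation and its gradient. -/

/-- Convexity of `x ↦ x (φ + log x)`: difference quotients along the segment from `x` to `y` lie
between the tangent slope at `x` and the full chord. Neither bound depends on `ε`, so together they
serve as a dominating function. -/
theorem sub_mul_le_slope_and_le {x y ε φ : ℝ} (hx : 0 < x) (hy : 0 < y) (hε : 0 < ε)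
    (hε1 : ε < 1) :
    (y - x) * (φ + Real.log x + 1) ≤
      (((1 - ε) * x + ε * y) * (φ + Real.log ((1 - ε) * x + ε * y)) - x * (φ + Real.log x)) / ε ∧
    (((1 - ε) * x + ε * y) * (φ + Real.log ((1 - ε) * x + ε * y)) - x * (φ + Real.log x)) / ε ≤
      y * (φ + Real.log y) - x * (φ + Real.log x) := by
  set w := (1 - ε) * x + ε * y with hw
  have h1ε : 0 < 1 - ε := by linarith
  have hw0 : 0 < w := by positivity
  constructor
  · rw [le_div_iff₀ hε]
    have h := Real.log_le_sub_one_of_pos (div_pos hx hw0)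
    rw [Real.log_div hx.ne' hw0.ne'] at h
    have h2 := mul_le_mul_of_nonneg_left h hw0.le
    have h3 : w * (x / w - 1) = x - w := by field_simp
    have h4 : w - x = ε * (y - x) := by rw [hw]; ring
    nlinarith
  · rw [div_le_iff₀ hε]
    have h := Real.convexOn_mul_log.2 (mem_Ici.2 hx.le) (mem_Ici.2 hy.le) h1ε.le hε.le (by ring)
    simp only [smul_eq_mul] at h
    rw [← hw] at h
    have h4 : w * φ = (1 - ε) * (x * φ) + ε * (y * φ) := by rw [hw]; ring
    nlinarith

theorem tendsto_entropy_slope {x y φ : ℝ} (hx : 0 < x) :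
    Tendsto (fun ε : ℝ =>
      (((1 - ε) * x + ε * y) * (φ + Real.log ((1 - ε) * x + ε * y)) - x * (φ + Real.log x)) / ε)
      (𝓝[>] 0) (𝓝 ((y - x) * (φ + Real.log x + 1))) := by
  have hl : HasDerivAt (fun ε : ℝ => (1 - ε) * x + ε * y) (y - x) 0 := by
    have h := (((hasDerivAt_id (0 : ℝ)).const_sub 1).mul_const x).add
      ((hasDerivAt_id (0 : ℝ)).mul_const y)
    exact h.congr_deriv (by ring)
  have hw : (1 - (0 : ℝ)) * x + 0 * y = x := by ring
  have h2 := hl.mul ((hl.log (by rw [hw]; exact hx.ne')).const_add φ)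
  have h3 := h2.tendsto_slope_zero_right
  simp only [Pi.mul_apply, zero_add, hw, smul_eq_mul] at h3
  refine (h3.congr fun ε => ?_).trans_eq ?_
  · rw [inv_mul_eq_div]
  · congr 1; field_simp

namespace IsRegularModel

variable {Ω : Set (Param d)} {ν : Measure Z} {q : Z → Param d → ℝ} {f : Z → ℝ}
  [SigmaFinite ν] {ρ : Measure (Param d)}

theorem integrable_entropy (hρ : ρ ∈ finiteLaws Ω ν q f) :
    Integrable (fun z => mixtureDensity q ρ z * (f z + Real.log (mixtureDensity q ρ z))) ν := by
  obtain ⟨hp, -, hi⟩ := hρ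
  refine hi.integral_prod_right.congr (ae_of_all _ fun z => ?_)
  simp only [integral_mul_const]
  rfl

theorem negELBO_eq (hρ : ρ ∈ finiteLaws Ω ν q f) :
    negELBO ν q f ρ =
      ∫ z, mixtureDensity q ρ z * (f z + Real.log (mixtureDensity q ρ z)) ∂ν := by
  obtain ⟨hp, -, hi⟩ := hρ
  rw [negELBO, integral_integral_swap
    (f := fun l z => q z l * (f z + Real.log (mixtureDensity q ρ z))) hi]
  simp only [integral_mul_const]
  rfl

omit [SigmaFinite ν] in
theorem measurable_potential [IsProbabilityMeasure ρ] (hM : IsRegularModel Ω ν q f) :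
    Measurable (fun z => f z + Real.log (mixtureDensity q ρ z)) :=
  hM.measurable_f.add (Real.measurable_log.comp hM.measurable_mixtureDensity)

/-- The potential does not depend on `l` and `q ≥ 0` on `Ω`, so integrating the modulus over `l`
leaves exactly the modulus of the entropy integrand. This certifies that perturbed laws still have
finite `L`. -/
theorem mem_finiteLaws [IsProbabilityMeasure ρ] (hM : IsRegularModel Ω ν q f) (hρ : ρ Ωᶜ = 0)
    (hi : Integrable
      (fun z => mixtureDensity q ρ z * (f z + Real.log (mixtureDensity q ρ z))) ν) :
    ρ ∈ finiteLaws Ω ν q f := by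
  have hae : ∀ᵐ l ∂ρ, l ∈ Ω := mem_ae_iff.2 hρ
  have hm : Measurable (fun p : Param d × Z =>
      q p.2 p.1 * (f p.2 + Real.log (mixtureDensity q ρ p.2))) :=
    (hM.measurable_q.comp measurable_swap).mul (hM.measurable_potential.comp measurable_snd)
  refine ⟨inferInstance, hρ, (integrable_prod_iff' hm.aestronglyMeasurable).2 ⟨?_, ?_⟩⟩
  · filter_upwards [hM.ae_integrable hρ] with z hz using hz.mul_const _
  · refine hi.norm.congr (ae_of_all _ fun z => ?_)
    simp only [norm_mul, integral_mul_const]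
    congr 1
    have h0 : ∀ᵐ l ∂ρ, 0 ≤ q z l := by
      filter_upwards [hae] with l hl using (hM.pos z l hl).le
    rw [mixtureDensity, Real.norm_of_nonneg (integral_nonneg_of_ae h0)]
    exact integral_congr_ae (by filter_upwards [h0] with l hl using (Real.norm_of_nonneg hl).symm)

/-- Gibbs' inequality: the negated ELBO is at least `1 - ∫ e^{-f}`. -/
theorem one_sub_evidence_le_negELBO (hM : IsRegularModel Ω ν q f)
    (hρ : ρ ∈ finiteLaws Ω ν q f) :
    1 - ∫ z, Real.exp (-f z) ∂ν ≤ negELBO ν q f ρ := by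
  have : IsProbabilityMeasure ρ := hρ.1
  have hi := hM.integrable_mixtureDensity hρ.2.1
  rw [negELBO_eq hρ, ← hM.integral_mixtureDensity hρ.2.1,
    ← integral_sub hi hM.integrable_evidence]
  refine integral_mono_ae (hi.sub hM.integrable_evidence) (integrable_entropy hρ) ?_
  filter_upwards [hM.ae_integrable hρ.2.1] with z hz
  have hu := hM.mixtureDensity_pos hρ.2.1 hz
  set u := mixtureDensity q ρ z
  -- Multiplied by `u`, this reads `u - u (f + log u) ≤ exp (-f)`.
  have h := Real.add_one_le_exp (-f z - Real.log u)
  have h2 : u * Real.exp (-f z - Real.log u) = Real.exp (-f z) := by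
    rw [Real.exp_sub, Real.exp_log hu]; field_simp
  have h3 := mul_le_mul_of_nonneg_left h hu.le
  nlinarith

omit [SigmaFinite ν] in
theorem exists_isCompact_half_le [IsProbabilityMeasure ρ] (hM : IsRegularModel Ω ν q f)
    (hρ : ρ Ωᶜ = 0) {K₀ : Set (Param d)} (hK₀ : IsCompact K₀) (hK₀Ω : K₀ ⊆ Ω) :
    ∃ K, IsCompact K ∧ K ⊆ Ω ∧ K₀ ⊆ K ∧ 1 / 2 ≤ ρ.real K := by
  have h1 : ρ Ω = 1 := (prob_compl_eq_zero_iff hM.isOpen.measurableSet).1 hρ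
  obtain ⟨K, hKΩ, hK, hlt⟩ := hM.isOpen.exists_lt_isCompact (μ := ρ) (r := 1 / 2)
    (by rw [h1]; exact ENNReal.half_lt_self one_ne_zero ENNReal.one_ne_top)
  refine ⟨K ∪ K₀, hK.union hK₀, union_subset hKΩ hK₀Ω, subset_union_right, ?_⟩
  have := ENNReal.toReal_mono (measure_ne_top ρ _)
    (hlt.le.trans (measure_mono (subset_union_left (t := K₀))))
  simpa [Measure.real] using this

/-- Domination near a compact set for a fixed mixing measure. -/
theorem exists_bound_of_law [IsProbabilityMeasure ρ] (hM : IsRegularModel Ω ν q f)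
    (hρ : ρ Ωᶜ = 0) {K₀ : Set (Param d)} (hK₀ : IsCompact K₀) (hK₀Ω : K₀ ⊆ Ω) :
    ∃ B : Z → ℝ, Integrable B ν ∧ ∀ᵐ z ∂ν, ∀ l ∈ K₀,
      q z l * |f z + Real.log (mixtureDensity q ρ z)| ≤ B z ∧
      ‖gradient (q z) l‖ * |f z + Real.log (mixtureDensity q ρ z)| ≤ B z := by
  obtain ⟨K, hK, hKΩ, hsub, hhalf⟩ := hM.exists_isCompact_half_le hρ hK₀ hK₀Ω
  obtain ⟨b, hb, -, hbd⟩ := hM.exists_bound hK hKΩ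
  refine ⟨_, (hb.const_mul (1 + |Real.log (1 / 2)|)).add (hM.integrable_mixtureDensity hρ), ?_⟩
  filter_upwards [hM.ae_integrable hρ] with z hz l hl
  exact hbd ρ hρ (1 / 2) (by norm_num) hhalf z hz l (hsub hl)

theorem integrable_mul_potential [IsProbabilityMeasure ρ] (hM : IsRegularModel Ω ν q f)
    (hρ : ρ Ωᶜ = 0) {l : Param d} (hl : l ∈ Ω) :
    Integrable (fun z => q z l * (f z + Real.log (mixtureDensity q ρ z))) ν := by
  obtain ⟨B, hB, hbd⟩ := hM.exists_bound_of_law hρ (isCompact_singleton (x := l)) (by simpa)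
  refine hB.mono' ((hM.measurable_left l).mul hM.measurable_potential).aestronglyMeasurable ?_
  filter_upwards [hbd] with z hz
  rw [norm_mul, Real.norm_of_nonneg (hM.pos z l hl).le]
  exact (hz l rfl).1

omit [SigmaFinite ν] in
theorem integrable_mul_self (hM : IsRegularModel Ω ν q f)
    {l : Param d} (hl : l ∈ Ω) :
    Integrable (fun z => q z l * (f z + Real.log (q z l))) ν := by
  obtain ⟨b, hb, hbd, -⟩ := hM.exists_bound (isCompact_singleton (x := l)) (by simpa)
  refine hb.mono' ((hM.measurable_left l).mul (hM.measurable_f.add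
    (Real.measurable_log.comp (hM.measurable_left l)))).aestronglyMeasurable ?_
  refine ae_of_all _ fun z => ?_
  rw [norm_mul, Real.norm_of_nonneg (hM.pos z l hl).le]
  exact (mul_le_mul_of_nonneg_left (abs_add_le _ _) (hM.pos z l hl).le).trans (hbd z l rfl)

/-- The directional derivative of the negated ELBO at `ρ` towards the Dirac mass at `l`. -/
theorem tendsto_slope_negELBO_dirac (hM : IsRegularModel Ω ν q f)
    (hρ : ρ ∈ finiteLaws Ω ν q f) {l : Param d} (hl : l ∈ Ω) :
    Tendsto (fun ε : ℝ =>
        (negELBO ν q f (ENNReal.ofReal (1 - ε) • ρ + ENNReal.ofReal ε • Measure.dirac l)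
          - negELBO ν q f ρ) / ε) (𝓝[>] 0)
      (𝓝 ((∫ z, q z l * (f z + Real.log (mixtureDensity q ρ z)) ∂ν) - negELBO ν q f ρ)) := by
  have hp : IsProbabilityMeasure ρ := hρ.1
  have hint := hM.ae_integrable hρ.2.1
  have hU := integrable_entropy hρ
  have hV := hM.integrable_mul_potential hρ.2.1 hl
  have hS := hM.integrable_mul_self hl
  have hQ := hM.integrable_mixtureDensity hρ.2.1
  have hql := hM.integrable_density hl
  set u := mixtureDensity q ρ with hu
  let W : ℝ → Z → ℝ := fun ε z => (1 - ε) * u z + ε * q z l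
  have hlow : Integrable (fun z => (q z l - u z) * (f z + Real.log (u z) + 1)) ν := by
    convert ((hV.sub hU).add hql).sub hQ using 1
    ext z; simp only [Pi.sub_apply, Pi.add_apply]; ring
  have hmeasW : ∀ ε, Measurable (W ε) := fun ε =>
    (measurable_const.mul hM.measurable_mixtureDensity).add
      (measurable_const.mul (hM.measurable_left l))
  have hbound : ∀ ε : ℝ, 0 < ε → ε < 1 → ∀ᵐ z ∂ν,
      ‖(W ε z * (f z + Real.log (W ε z)) - u z * (f z + Real.log (u z))) / ε‖ ≤
        |(q z l - u z) * (f z + Real.log (u z) + 1)| +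
        |q z l * (f z + Real.log (q z l)) - u z * (f z + Real.log (u z))| := by
    intro ε h0 h1
    filter_upwards [hint] with z hz
    have h := sub_mul_le_slope_and_le (φ := f z) (hM.mixtureDensity_pos hρ.2.1 hz)
      (hM.pos z l hl) h0 h1
    rw [Real.norm_eq_abs, abs_le]
    constructor
    · refine le_trans ?_ h.1
      linarith [neg_abs_le ((q z l - u z) * (f z + Real.log (u z) + 1)),
        abs_nonneg (q z l * (f z + Real.log (q z l)) - u z * (f z + Real.log (u z)))]
    · refine h.2.trans ?_
      linarith [le_abs_self (q z l * (f z + Real.log (q z l)) - u z * (f z + Real.log (u z))),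
        abs_nonneg ((q z l - u z) * (f z + Real.log (u z) + 1))]
  have hBint := hlow.abs.add (hS.sub hU).abs
  have hmeas : ∀ ε, Measurable
      (fun z => (W ε z * (f z + Real.log (W ε z)) - u z * (f z + Real.log (u z))) / ε) :=
    fun ε => (((hmeasW ε).mul (hM.measurable_f.add (Real.measurable_log.comp (hmeasW ε)))).sub
      (hM.measurable_mixtureDensity.mul hM.measurable_potential)).div_const ε
  have hev : ∀ᶠ ε : ℝ in 𝓝[>] 0, 0 < ε ∧ ε < 1 := Ioo_mem_nhdsGT one_pos
  have hlim := tendsto_integral_filter_of_dominated_convergence (μ := ν) (l := 𝓝[>] (0 : ℝ))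
    (F := fun ε z => (W ε z * (f z + Real.log (W ε z)) - u z * (f z + Real.log (u z))) / ε)
    (f := fun z => (q z l - u z) * (f z + Real.log (u z) + 1)) _
    (Eventually.of_forall fun ε => (hmeas ε).aestronglyMeasurable)
    (hev.mono fun ε h => hbound ε h.1 h.2) hBint
    (by filter_upwards [hint] with z hz
        exact tendsto_entropy_slope (hM.mixtureDensity_pos hρ.2.1 hz))
  have hval : ∫ z, (q z l - u z) * (f z + Real.log (u z) + 1) ∂ν =
      (∫ z, q z l * (f z + Real.log (u z)) ∂ν) - negELBO ν q f ρ := by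
    rw [negELBO_eq hρ, ← integral_sub hV hU]
    -- The extra `1` from differentiating `x log x` drops out since both densities have mass one.
    have h1 : ∫ z, (q z l - u z) ∂ν = 0 := by
      rw [integral_sub hql hQ, hM.integral_eq_one l hl, hu, hM.integral_mixtureDensity hρ.2.1,
        sub_self]
    have hadd := (integral_add (hV.sub hU) (hql.sub hQ)).symm
    simp only [Pi.sub_apply] at hadd
    rw [← add_zero (∫ z, (_ - _) ∂ν), ← h1, hadd]
    exact integral_congr_ae (ae_of_all _ fun z => by ring)
  rw [← hval]
  refine hlim.congr' ?_
  filter_upwards [hev] with ε hε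
  have h1ε : 0 ≤ 1 - ε := by linarith [hε.2]
  set ρε := ENNReal.ofReal (1 - ε) • ρ + ENNReal.ofReal ε • Measure.dirac l with hρε
  have hmix : ∀ᵐ z ∂ν, mixtureDensity q ρε z = W ε z := by
    filter_upwards [hint] with z hz
    have hd : Integrable (q z) (Measure.dirac l) := by
      refine integrable_dirac' (hM.measurable_right z).stronglyMeasurable ?_
      exact enorm_lt_top
    rw [mixtureDensity, hρε, integral_add_measure (hz.smul_measure ENNReal.ofReal_ne_top)
      (hd.smul_measure ENNReal.ofReal_ne_top), integral_smul_measure, integral_smul_measure,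
      integral_dirac, ENNReal.toReal_ofReal h1ε, ENNReal.toReal_ofReal hε.1.le]
    rfl
  have hprob : IsProbabilityMeasure ρε := by
    refine ⟨?_⟩
    simp only [hρε, Measure.add_apply, Measure.smul_apply, measure_univ, smul_eq_mul, mul_one]
    rw [← ENNReal.ofReal_add h1ε hε.1.le]; simp
  have hnull : ρε Ωᶜ = 0 := by
    simp [hρε, hρ.2.1, hl]
  -- Integrability at the perturbed law is recovered from the dominated difference quotient:
  -- multiply by `ε` and add the integrand at `ρ`.
  have hWint : Integrable (fun z => W ε z * (f z + Real.log (W ε z))) ν := by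
    have h1 := (hBint.mono' (hmeas ε).aestronglyMeasurable (hbound ε hε.1 hε.2)).const_mul ε
    refine (h1.add hU).congr (ae_of_all _ fun z => ?_)
    simp only [Pi.add_apply]
    rw [mul_div_cancel₀ _ hε.1.ne']; ring
  have hmix' : ∀ᵐ z ∂ν, W ε z * (f z + Real.log (W ε z)) =
      mixtureDensity q ρε z * (f z + Real.log (mixtureDensity q ρε z)) := by
    filter_upwards [hmix] with z hz using by rw [hz]
  have hmem : ρε ∈ finiteLaws Ω ν q f := hM.mem_finiteLaws hnull (hWint.congr hmix')
  rw [negELBO_eq hmem, negELBO_eq hρ, ← integral_congr_ae hmix', ← integral_sub hWint hU,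
    integral_div]

/-- Every first variation is, up to a constant, the potential `l ↦ ∫ q(z|l) (f + log q_ρ) dz`. -/
theorem firstVariation_eq (hM : IsRegularModel Ω ν q f) {δ : Param d → ℝ}
    (hδ : IsFirstVariation Ω ν q f ρ δ) {l : Param d} (hl : l ∈ Ω) :
    δ l = (∫ z, q z l * (f z + Real.log (mixtureDensity q ρ z)) ∂ν) +
      ((∫ l, δ l ∂ρ) - negELBO ν q f ρ) := by
  have h1 := (hδ.2.2 (Measure.dirac l) {l} inferInstance isCompact_singleton (by simpa)
    (by simp)).2
  have h2 := tendsto_nhds_unique h1 (hM.tendsto_slope_negELBO_dirac hδ.1 hl)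
  rw [integral_dirac] at h2
  linarith

theorem integrable_potential_smul_gradient [IsProbabilityMeasure ρ] (hM : IsRegularModel Ω ν q f)
    (hρ : ρ Ωᶜ = 0) {l : Param d} (hl : l ∈ Ω) :
    Integrable (fun z => (f z + Real.log (mixtureDensity q ρ z)) • gradient (q z) l) ν := by
  obtain ⟨B, hB, hbd⟩ := hM.exists_bound_of_law hρ (isCompact_singleton (x := l)) (by simpa)
  refine hB.mono' (hM.measurable_potential.smul (hM.measurable_gradient hl)).aestronglyMeasurable ?_
  filter_upwards [hbd] with z hz
  rw [norm_smul, mul_comm]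
  exact (hz l rfl).2

theorem hasGradientAt_potential [IsProbabilityMeasure ρ] (hM : IsRegularModel Ω ν q f)
    (hρ : ρ Ωᶜ = 0) {l : Param d} (hl : l ∈ Ω) :
    HasGradientAt (fun l => ∫ z, q z l * (f z + Real.log (mixtureDensity q ρ z)) ∂ν)
      (∫ z, (f z + Real.log (mixtureDensity q ρ z)) • gradient (q z) l ∂ν) l := by
  obtain ⟨r, hr, hsub⟩ := Metric.nhds_basis_closedBall.mem_iff.1 (hM.isOpen.mem_nhds hl)
  obtain ⟨B, hB, hbd⟩ := hM.exists_bound_of_law hρ (isCompact_closedBall l r) hsub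
  have hmem := Metric.closedBall_mem_nhds l hr
  have h := hasFDerivAt_integral_of_dominated_of_fderiv_le (𝕜 := ℝ) (μ := ν) (x₀ := l)
    (F := fun l z => q z l * (f z + Real.log (mixtureDensity q ρ z)))
    (F' := fun l z => (f z + Real.log (mixtureDensity q ρ z)) •
      (InnerProductSpace.toDual ℝ (Param d)) (gradient (q z) l)) (bound := B) hmem
    (Eventually.of_forall fun l' =>
      ((hM.measurable_left l').mul hM.measurable_potential).aestronglyMeasurable)
    (hM.integrable_mul_potential hρ hl)
    (hM.measurable_potential.aestronglyMeasurable.smul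
      ((InnerProductSpace.toDual ℝ (Param d)).continuous.comp_aestronglyMeasurable
        (hM.measurable_gradient hl).aestronglyMeasurable))
    (by filter_upwards [hbd] with z hz l' hl'
        rw [norm_smul, LinearIsometryEquiv.norm_map, mul_comm]
        exact (hz l' hl').2) hB
    (by refine ae_of_all _ fun z l' hl' => ?_
        exact (hM.hasGradientAt z (hsub hl')).hasFDerivAt.mul_const _)
  rw [hasGradientAt_iff_hasFDerivAt]
  refine h.congr_fderiv ?_
  ext w
  have hG := hM.integrable_potential_smul_gradient hρ hl
  have hG' : Integrable (fun z => (f z + Real.log (mixtureDensity q ρ z)) •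
      (InnerProductSpace.toDual ℝ (Param d)) (gradient (q z) l)) ν := by
    refine hG.norm.mono' (hM.measurable_potential.aestronglyMeasurable.smul
      ((InnerProductSpace.toDual ℝ (Param d)).continuous.comp_aestronglyMeasurable
        (hM.measurable_gradient hl).aestronglyMeasurable)) (ae_of_all _ fun z => ?_)
    rw [norm_smul, norm_smul, LinearIsometryEquiv.norm_map]
  rw [InnerProductSpace.toDual_apply_apply, ContinuousLinearMap.integral_apply hG',
    real_inner_comm, ← integral_inner hG]
  refine integral_congr_ae (ae_of_all _ fun z => ?_)
  simp only [FunLike.coe_smul, Pi.smul_apply, InnerProductSpace.toDual_apply_apply,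
    real_inner_smul_right, smul_eq_mul]
  rw [real_inner_comm]

theorem gradient_firstVariation_eq (hM : IsRegularModel Ω ν q f) {δ : Param d → ℝ}
    (hδ : IsFirstVariation Ω ν q f ρ δ) {l g : Param d} (hl : l ∈ Ω) (hg : HasGradientAt δ g l) :
    g = ∫ z, (f z + Real.log (mixtureDensity q ρ z)) • gradient (q z) l ∂ν := by
  have hp : IsProbabilityMeasure ρ := hδ.1.1
  refine hg.unique ?_
  have h := (hM.hasGradientAt_potential hδ.1.2.1 hl).hasFDerivAt.add_const
    ((∫ l, δ l ∂ρ) - negELBO ν q f ρ)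
  rw [hasGradientAt_iff_hasFDerivAt]
  refine h.congr_of_eventuallyEq ?_
  filter_upwards [hM.isOpen.mem_nhds hl] with l' hl' using hM.firstVariation_eq hδ hl'

end IsRegularModel

/-! ### Integration by parts against a logarithm. -/

/-- By compactness `F` has a positive minimum `m`, and `log` is `m⁻¹`-Lipschitz on `[m, ∞)`. -/
theorem AbsolutelyContinuousOnInterval.log {F : ℝ → ℝ} {a b : ℝ}
    (hF : AbsolutelyContinuousOnInterval F a b) (hpos : ∀ s ∈ uIcc a b, 0 < F s) :
    AbsolutelyContinuousOnInterval (fun s => Real.log (F s)) a b := by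
  obtain ⟨s₀, hs₀, hmin⟩ := isCompact_uIcc.exists_isMinOn nonempty_uIcc hF.continuousOn
  set m := F s₀ with hm
  have hm0 : 0 < m := hpos s₀ hs₀
  have hlip : ∀ x y, m ≤ x → m ≤ y → dist (Real.log x) (Real.log y) ≤ m⁻¹ * dist x y := by
    have key : ∀ x y, m ≤ x → m ≤ y → Real.log x - Real.log y ≤ m⁻¹ * |x - y| := by
      intro x y hx hy
      have hx0 := hm0.trans_le hx
      have hy0 := hm0.trans_le hy
      rw [← Real.log_div hx0.ne' hy0.ne']
      calc Real.log (x / y) ≤ x / y - 1 := Real.log_le_sub_one_of_pos (div_pos hx0 hy0)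
        _ = y⁻¹ * (x - y) := by field_simp
        _ ≤ y⁻¹ * |x - y| := by gcongr; exact le_abs_self _
        _ ≤ m⁻¹ * |x - y| := by gcongr
    intro x y hx hy
    rw [Real.dist_eq, Real.dist_eq, abs_le]
    have := key y x hy hx
    rw [abs_sub_comm] at this
    exact ⟨by linarith, key x y hx hy⟩
  rw [absolutelyContinuousOnInterval_iff] at hF ⊢
  intro ε hε
  obtain ⟨δ, hδ, h⟩ := hF (m * ε) (by positivity)
  refine ⟨δ, hδ, fun E hE hsum => ?_⟩
  have h1 := h E hE hsum
  calc ∑ i ∈ Finset.range E.1, dist (Real.log (F (E.2 i).1)) (Real.log (F (E.2 i).2))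
      ≤ ∑ i ∈ Finset.range E.1, m⁻¹ * dist (F (E.2 i).1) (F (E.2 i).2) :=
        Finset.sum_le_sum fun i hi =>
          hlip _ _ (hmin (hE.1 i hi).1) (hmin (hE.1 i hi).2)
    _ = m⁻¹ * ∑ i ∈ Finset.range E.1, dist (F (E.2 i).1) (F (E.2 i).2) :=
        (Finset.mul_sum _ _ _).symm
    _ < m⁻¹ * (m * ε) := by gcongr
    _ = ε := by field_simp

/-- Integration by parts of `φ (c + log F)` for two primitives `φ` and `F > 0`. -/
theorem integral_mul_log_by_parts {F g φ φ' : ℝ → ℝ} {t c : ℝ} (ht : 0 ≤ t)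
    (hg : IntervalIntegrable g volume 0 t) (hφ' : IntervalIntegrable φ' volume 0 t)
    (hF : ∀ s ∈ Icc 0 t, F s = F 0 + ∫ r in 0..s, g r)
    (hφ : ∀ s ∈ Icc 0 t, φ s = φ 0 + ∫ r in 0..s, φ' r)
    (hpos : ∀ s ∈ Icc 0 t, 0 < F s) :
    ∫ s in 0..t, (φ' s * (c + Real.log (F s)) + φ s * (g s / F s)) =
      φ t * (c + Real.log (F t)) - φ 0 * (c + Real.log (F 0)) := by
  have hI : uIcc 0 t = Icc 0 t := uIcc_of_le ht
  -- `F` and `φ` are known only on `[0, t]`, so derivatives are taken on the globally defined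
  -- primitives `G` and `Ψ`, which agree with them there.
  let G : ℝ → ℝ := fun s => F 0 + ∫ r in 0..s, g r
  let Ψ : ℝ → ℝ := fun s => φ 0 + ∫ r in 0..s, φ' r
  have hconst : ∀ a : ℝ, AbsolutelyContinuousOnInterval (fun _ : ℝ => a) 0 t := fun a =>
    (LipschitzWith.const a).lipschitzOnWith.absolutelyContinuousOnInterval
  have hGac : AbsolutelyContinuousOnInterval G 0 t :=
    (hconst _).add (hg.absolutelyContinuousOnInterval_intervalIntegral left_mem_uIcc)
  have hΨac : AbsolutelyContinuousOnInterval Ψ 0 t :=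
    (hconst _).add (hφ'.absolutelyContinuousOnInterval_intervalIntegral left_mem_uIcc)
  have hGpos : ∀ s ∈ uIcc 0 t, 0 < G s := fun s hs => by
    rw [hI] at hs; rw [show G s = F s from (hF s hs).symm]; exact hpos s hs
  have hHac : AbsolutelyContinuousOnInterval (fun s => c + Real.log (G s)) 0 t :=
    (hconst c).add (hGac.log hGpos)
  have h := hΨac.integral_deriv_mul_eq_sub hHac
  have e0 : (0 : ℝ) ∈ Icc 0 t := left_mem_Icc.2 ht
  have et : t ∈ Icc 0 t := right_mem_Icc.2 ht
  rw [show Ψ t = φ t from (hφ t et).symm, show G t = F t from (hF t et).symm,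
    show Ψ 0 = φ 0 from (hφ 0 e0).symm, show G 0 = F 0 from (hF 0 e0).symm] at h
  rw [← h]
  refine intervalIntegral.integral_congr_ae ?_
  filter_upwards [hg.ae_hasDerivAt_integral, hφ'.ae_hasDerivAt_integral] with s h1 h2 hs
  have hs' : s ∈ uIcc 0 t := uIoc_subset_uIcc hs
  have hG : HasDerivAt G (g s) s := (h1 hs' 0 left_mem_uIcc).const_add _
  have hΨ : HasDerivAt Ψ (φ' s) s := (h2 hs' 0 left_mem_uIcc).const_add _
  rw [hΨ.deriv, ((hG.log (hGpos s hs').ne').const_add c).deriv]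
  rw [hI] at hs'
  rw [show Ψ s = φ s from (hφ s hs').symm, show G s = F s from (hF s hs').symm]

/-! ### Rates along particle paths, and compact exhaustion of `Ω`. -/

/-- The velocity `-∇ δL(ρ)`, written out. -/
def velocityField (ν : Measure Z) (q : Z → Param d → ℝ) (f : Z → ℝ) (ρ : Measure (Param d))
    (l : Param d) : Param d :=
  -∫ z, (f z + Real.log (mixtureDensity q ρ z)) • gradient (q z) l ∂ν

/-- The velocity of the particle `X s ξ`, preconditioned by `C`. -/
def drift {Ξ : Type*} [MeasurableSpace Ξ] (ν : Measure Z) (q : Z → Param d → ℝ) (f : Z → ℝ)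
    (C : Param d → Matrix (Fin d) (Fin d) ℝ) (P : Measure Ξ) (X : ℝ → Ξ → Param d)
    (s : ℝ) (ξ : Ξ) : Param d :=
  Matrix.toEuclideanLin (C (X s ξ)) (velocityField ν q f (P.map (X s)) (X s ξ))

/-- The time derivative of `q z (X s ξ)`. -/
def densityRate {Ξ : Type*} [MeasurableSpace Ξ] (ν : Measure Z) (q : Z → Param d → ℝ) (f : Z → ℝ)
    (C : Param d → Matrix (Fin d) (Fin d) ℝ) (P : Measure Ξ) (X : ℝ → Ξ → Param d)
    (s : ℝ) (ξ : Ξ) (z : Z) : ℝ :=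
  inner ℝ (gradient (q z) (X s ξ)) (drift ν q f C P X s ξ)

/-- The pointwise dissipation rate `⟨v, C v⟩` of the particle `X s ξ`. -/
def dissipationRate {Ξ : Type*} [MeasurableSpace Ξ] (ν : Measure Z) (q : Z → Param d → ℝ)
    (f : Z → ℝ) (C : Param d → Matrix (Fin d) (Fin d) ℝ) (P : Measure Ξ) (X : ℝ → Ξ → Param d)
    (s : ℝ) (ξ : Ξ) : ℝ :=
  inner ℝ (velocityField ν q f (P.map (X s)) (X s ξ)) (drift ν q f C P X s ξ)

/-- The share of the particle `X s ξ` in the growth of the mixture density. -/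
def transferRate {Ξ : Type*} [MeasurableSpace Ξ] (ν : Measure Z) (q : Z → Param d → ℝ)
    (f : Z → ℝ) (C : Param d → Matrix (Fin d) (Fin d) ℝ) (P : Measure Ξ) (X : ℝ → Ξ → Param d)
    (s : ℝ) (ξ : Ξ) (z : Z) : ℝ :=
  q z (X s ξ) *
    ((∫ ξ', densityRate ν q f C P X s ξ' z ∂P) / mixtureDensity q (P.map (X s)) z)

/-- A flow all of whose paths are continuous curves in `Ω`, indexed by the whole line. -/
structure IsContinuousFlow {Ξ : Type*} [MeasurableSpace Ξ] (Ω : Set (Param d)) (ν : Measure Z)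
    (q : Z → Param d → ℝ) (f : Z → ℝ) (C : Param d → Matrix (Fin d) (Fin d) ℝ)
    (P : Measure Ξ) (X : ℝ → Ξ → Param d) : Prop where
  model : IsRegularModel Ω ν q f
  continuousOn_matrix : ContinuousOn C Ω
  posDef : ∀ l ∈ Ω, (C l).PosDef
  measurable : ∀ s, Measurable (X s)
  continuous : ∀ ξ, Continuous fun s => X s ξ
  mem : ∀ s ξ, X s ξ ∈ Ω
  mem_finiteLaws : ∀ s, 0 ≤ s → P.map (X s) ∈ finiteLaws Ω ν q f
  ode : ∀ᵐ ξ ∂P, ∀ s, 0 ≤ s →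
    HasDerivWithinAt (fun r => X r ξ) (drift ν q f C P X s ξ) (Ici 0) s
  rate : ∀ T : ℝ, 0 < T →
    ∫⁻ s in Icc 0 T, ∫⁻ ξ, ∫⁻ z, ‖densityRate ν q f C P X s ξ z‖ₑ ∂ν ∂P < ⊤

/-- A monotone exhaustion of an open set by compact sets that absorbs every compact subset. -/
def compactCore (Ω : Set (Param d)) (n : ℕ) : Set (Param d) :=
  Metric.closedBall 0 n \ Metric.thickening (1 / ((n : ℝ) + 1)) Ωᶜ

theorem isCompact_compactCore (Ω : Set (Param d)) (n : ℕ) : IsCompact (compactCore Ω n) :=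
  (isCompact_closedBall 0 (n : ℝ)).diff Metric.isOpen_thickening

theorem compactCore_subset (Ω : Set (Param d)) (n : ℕ) : compactCore Ω n ⊆ Ω := by
  intro x hx
  by_contra h
  exact hx.2 (Metric.self_subset_thickening (by positivity) _ h)

theorem monotone_compactCore (Ω : Set (Param d)) : Monotone (compactCore Ω) := by
  intro m n hmn
  refine sdiff_subset_sdiff (Metric.closedBall_subset_closedBall (by exact_mod_cast hmn))
    (Metric.thickening_mono ?_ _)
  gcongr

theorem exists_subset_compactCore {Ω S : Set (Param d)} (hΩ : IsOpen Ω) (hS : IsCompact S)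
    (hSΩ : S ⊆ Ω) : ∃ n, S ⊆ compactCore Ω n := by
  obtain ⟨δ, hδ, hdisj⟩ := (disjoint_compl_right_iff_subset.2 hSΩ).exists_thickenings hS
    hΩ.isClosed_compl
  obtain ⟨R, hR⟩ := hS.isBounded.subset_closedBall 0
  obtain ⟨n₁, hn₁⟩ := exists_nat_ge R
  obtain ⟨n₂, hn₂⟩ := exists_nat_one_div_lt hδ
  refine ⟨max n₁ n₂, fun x hx => ⟨?_, fun hx' => ?_⟩⟩
  · refine Metric.closedBall_subset_closedBall (hn₁.trans ?_) (hR hx)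
    exact_mod_cast le_max_left _ _
  · refine disjoint_left.1 hdisj (Metric.self_subset_thickening hδ _ hx)
      (Metric.thickening_mono (le_trans ?_ hn₂.le) _ hx')
    have : (n₂ : ℝ) ≤ ((max n₁ n₂ : ℕ) : ℝ) := by exact_mod_cast le_max_right _ _
    gcongr

/-- `C` is arbitrary off `Ω`, so measurability is available only along maps with values in `Ω`. -/
theorem measurable_toEuclideanLin_comp {A : Type*} [MeasurableSpace A] {Ω : Set (Param d)}
    {C : Param d → Matrix (Fin d) (Fin d) ℝ} (hC : ContinuousOn C Ω) {Y : A → Param d}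
    (hY : Measurable Y) (hmem : ∀ a, Y a ∈ Ω) {u : A → Param d} (hu : Measurable u) :
    Measurable (fun a => Matrix.toEuclideanLin (C (Y a)) (u a)) := by
  have hCij : ∀ i j, Measurable (fun a => C (Y a) i j) := by
    intro i j
    have hc : ContinuousOn (fun l => C l i j) Ω :=
      (continuous_apply_apply i j).comp_continuousOn hC
    have h1 := continuousOn_iff_continuous_domRestrict.1 hc
    exact h1.measurable.comp (hY.subtype_mk (h := hmem))
  have hv : ∀ j, Measurable (fun a => (u a) j) := fun j =>
    (measurable_pi_apply j).comp ((MeasurableEquiv.toLp 2 (Fin d → ℝ)).symm.measurable.comp hu)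
  have hco : Measurable (fun a => fun i => ∑ j, C (Y a) i j * (u a) j) :=
    measurable_pi_lambda _ fun i => Finset.measurable_sum _ fun j _ => (hCij i j).mul (hv j)
  exact (MeasurableEquiv.toLp 2 (Fin d → ℝ)).measurable.comp hco

theorem IsRegularModel.measurable_gradient_comp {A : Type*} [MeasurableSpace A]
    {Ω : Set (Param d)} {ν : Measure Z} {q : Z → Param d → ℝ} {f : Z → ℝ}
    (hM : IsRegularModel Ω ν q f) {Y : A → Param d} (hY : Measurable Y) (hmem : ∀ a, Y a ∈ Ω) :
    Measurable (fun p : A × Z => gradient (q p.2) (Y p.1)) := by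
  have := hM.measurable_indicator_gradient.comp
    (measurable_snd.prodMk (hY.comp (measurable_fst (β := Z))))
  simpa [Function.comp_def, hmem] using this

theorem IsRegularModel.measurable_velocityField_comp {A : Type*} [MeasurableSpace A]
    {Ω : Set (Param d)} {ν : Measure Z} [SigmaFinite ν] {q : Z → Param d → ℝ} {f : Z → ℝ}
    (hM : IsRegularModel Ω ν q f) {ρ : Measure (Param d)} [IsProbabilityMeasure ρ]
    {Y : A → Param d} (hY : Measurable Y) (hmem : ∀ a, Y a ∈ Ω) :
    Measurable (fun a => velocityField ν q f ρ (Y a)) := by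
  have hm : Measurable (fun p : A × Z =>
      (f p.2 + Real.log (mixtureDensity q ρ p.2)) • gradient (q p.2) (Y p.1)) :=
    (hM.measurable_potential.comp measurable_snd).smul (hM.measurable_gradient_comp hY hmem)
  exact (hm.stronglyMeasurable.integral_prod_right' (ν := ν)).measurable.neg

/-! ### Measurability, domination and continuity along the flow. -/

namespace IsContinuousFlow

variable {Ξ : Type*} [MeasurableSpace Ξ] {Ω : Set (Param d)} {ν : Measure Z} [SigmaFinite ν]
  {q : Z → Param d → ℝ} {f : Z → ℝ} {C : Param d → Matrix (Fin d) (Fin d) ℝ}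
  {P : Measure Ξ} [IsProbabilityMeasure P] {X : ℝ → Ξ → Param d}

section Measurability

omit [SigmaFinite ν] [IsProbabilityMeasure P]

theorem measurable_path (h : IsContinuousFlow Ω ν q f C P X) :
    Measurable (fun p : ℝ × Ξ => X p.1 p.2) :=
  measurable_uncurry_of_continuous_of_measurable (u := X)
    (fun ξ => h.continuous ξ) h.measurable

theorem mixtureDensity_map (h : IsContinuousFlow Ω ν q f C P X) (s : ℝ) (z : Z) :
    mixtureDensity q (P.map (X s)) z = ∫ ξ, q z (X s ξ) ∂P :=
  integral_map (h.measurable s).aemeasurable (h.model.measurable_right z).aestronglyMeasurable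

theorem measurable_density (h : IsContinuousFlow Ω ν q f C P X) :
    Measurable (fun p : (ℝ × Ξ) × Z => q p.2 (X p.1.1 p.1.2)) :=
  h.model.measurable_q.comp (measurable_snd.prodMk (h.measurable_path.comp measurable_fst))

theorem measurable_gradient (h : IsContinuousFlow Ω ν q f C P X) :
    Measurable (fun p : (ℝ × Ξ) × Z => gradient (q p.2) (X p.1.1 p.1.2)) :=
  h.model.measurable_gradient_comp h.measurable_path fun p => h.mem p.1 p.2

end Measurability

omit [SigmaFinite ν] in
theorem measurable_mixtureDensity (h : IsContinuousFlow Ω ν q f C P X) :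
    Measurable (fun p : ℝ × Z => mixtureDensity q (P.map (X p.1)) p.2) := by
  simp only [h.mixtureDensity_map]
  have hm : Measurable (fun p : (ℝ × Z) × Ξ => q p.1.2 (X p.1.1 p.2)) :=
    h.measurable_density.comp ((measurable_fst.fst.prodMk measurable_snd).prodMk
      measurable_fst.snd)
  exact (hm.stronglyMeasurable.integral_prod_right' (ν := P)).measurable

omit [SigmaFinite ν] in
theorem measurable_potential (h : IsContinuousFlow Ω ν q f C P X) :
    Measurable (fun p : ℝ × Z => f p.2 + Real.log (mixtureDensity q (P.map (X p.1)) p.2)) :=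
  (h.model.measurable_f.comp measurable_snd).add
    (Real.measurable_log.comp h.measurable_mixtureDensity)

theorem measurable_velocity (h : IsContinuousFlow Ω ν q f C P X) :
    Measurable (fun p : ℝ × Ξ => velocityField ν q f (P.map (X p.1)) (X p.1 p.2)) := by
  have hm : Measurable (fun p : (ℝ × Ξ) × Z =>
      (f p.2 + Real.log (mixtureDensity q (P.map (X p.1.1)) p.2)) •
        gradient (q p.2) (X p.1.1 p.1.2)) :=
    (h.measurable_potential.comp (measurable_fst.fst.prodMk measurable_snd)).smul
      h.measurable_gradient
  exact (hm.stronglyMeasurable.integral_prod_right' (ν := ν)).measurable.neg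

theorem measurable_drift (h : IsContinuousFlow Ω ν q f C P X) :
    Measurable (fun p : ℝ × Ξ => drift ν q f C P X p.1 p.2) :=
  measurable_toEuclideanLin_comp h.continuousOn_matrix h.measurable_path
    (fun p => h.mem p.1 p.2) h.measurable_velocity

theorem measurable_densityRate (h : IsContinuousFlow Ω ν q f C P X) :
    Measurable (fun p : (ℝ × Ξ) × Z => densityRate ν q f C P X p.1.1 p.1.2 p.2) :=
  h.measurable_gradient.inner (h.measurable_drift.comp measurable_fst)

theorem integrable_densityRate (h : IsContinuousFlow Ω ν q f C P X) {T : ℝ} (hT : 0 < T) :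
    Integrable (fun p : (ℝ × Ξ) × Z => densityRate ν q f C P X p.1.1 p.1.2 p.2)
      (((volume.restrict (Icc 0 T)).prod P).prod ν) := by
  refine ⟨h.measurable_densityRate.aestronglyMeasurable, ?_⟩
  have hm := h.measurable_densityRate.enorm
  rw [HasFiniteIntegral, lintegral_prod _ hm.aemeasurable,
    lintegral_prod _ (hm.lintegral_prod_right' (ν := ν)).aemeasurable]
  exact h.rate T hT

omit [SigmaFinite ν] in
theorem isProbabilityMeasure_map (h : IsContinuousFlow Ω ν q f C P X) (s : ℝ) :
    IsProbabilityMeasure (P.map (X s)) :=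
  Measure.isProbabilityMeasure_map (h.measurable s).aemeasurable

omit [SigmaFinite ν] [IsProbabilityMeasure P] in
theorem map_compl (h : IsContinuousFlow Ω ν q f C P X) (s : ℝ) : P.map (X s) Ωᶜ = 0 := by
  rw [Measure.map_apply (h.measurable s) h.model.isOpen.measurableSet.compl]
  convert measure_empty (μ := P)
  ext ξ; simp [h.mem]

omit [SigmaFinite ν] [IsProbabilityMeasure P] in
theorem hasDerivWithinAt_density (h : IsContinuousFlow Ω ν q f C P X) {ξ : Ξ} {s : ℝ}
    (hs : HasDerivWithinAt (fun r => X r ξ) (drift ν q f C P X s ξ) (Ici 0) s) (z : Z) :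
    HasDerivWithinAt (fun r => q z (X r ξ)) (densityRate ν q f C P X s ξ z) (Ici 0) s := by
  have := (h.model.hasGradientAt z (h.mem s ξ)).hasFDerivAt.comp_hasDerivWithinAt s hs
  exact this

omit [SigmaFinite ν] [IsProbabilityMeasure P] in
theorem density_eq_add_integral (h : IsContinuousFlow Ω ν q f C P X) {ξ : Ξ}
    (hξ : ∀ s, 0 ≤ s → HasDerivWithinAt (fun r => X r ξ) (drift ν q f C P X s ξ) (Ici 0) s)
    {z : Z} {t : ℝ} (ht : 0 ≤ t)
    (hi : IntervalIntegrable (fun s => densityRate ν q f C P X s ξ z) volume 0 t) :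
    q z (X t ξ) = q z (X 0 ξ) + ∫ s in 0..t, densityRate ν q f C P X s ξ z := by
  have hd := fun s hs => h.hasDerivWithinAt_density (hξ s hs) z
  rw [intervalIntegral.integral_eq_sub_of_hasDeriv_right_of_le ht
    (f := fun r => q z (X r ξ)) (fun s hs => (hd s hs.1).continuousWithinAt.mono Icc_subset_Ici_self)
    (fun s hs => (hd s hs.1.le).mono (Ioi_subset_Ici hs.1.le)) hi]
  ring

/-- For almost every `z`, the mixture density along the flow is a primitive of the mean rate, and
it is dominated by an integrable function of `z`. -/
theorem exists_dominating (h : IsContinuousFlow Ω ν q f C P X) {T : ℝ} (hT : 0 < T) :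
    ∃ M : Z → ℝ, Integrable M ν ∧ ∀ᵐ z ∂ν,
      Integrable (fun p : ℝ × Ξ => densityRate ν q f C P X p.1 p.2 z)
        ((volume.restrict (Icc 0 T)).prod P) ∧
      ∀ t ∈ Icc 0 T, Integrable (q z) (P.map (X t)) ∧
        0 < mixtureDensity q (P.map (X t)) z ∧
        mixtureDensity q (P.map (X t)) z ≤ M z ∧
        mixtureDensity q (P.map (X t)) z = mixtureDensity q (P.map (X 0)) z +
          ∫ s in 0..t, ∫ ξ, densityRate ν q f C P X s ξ z ∂P := by
  have hP := h.isProbabilityMeasure_map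
  have hJ := h.integrable_densityRate hT
  -- The initial mixture density plus a bound for its total variation over `[0, T]`. The exceptional
  -- set of `z` comes from this joint integrability alone, so one null set serves all times `t`.
  refine ⟨fun z => mixtureDensity q (P.map (X 0)) z +
    ∫ p, ‖densityRate ν q f C P X p.1 p.2 z‖ ∂((volume.restrict (Icc 0 T)).prod P),
    (h.model.integrable_mixtureDensity (h.map_compl 0)).add hJ.norm.integral_prod_right, ?_⟩
  filter_upwards [hJ.prod_left_ae, h.model.ae_integrable (h.map_compl 0)] with z hz hz0
  refine ⟨hz, fun t ht => ?_⟩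
  have hq0 : Integrable (fun ξ => q z (X 0 ξ)) P :=
    (integrable_map_measure (h.model.measurable_right z).aestronglyMeasurable
      (h.measurable 0).aemeasurable).1 hz0
  have hzt : Integrable (fun p : ℝ × Ξ => densityRate ν q f C P X p.1 p.2 z)
      ((volume.restrict (Ioc 0 t)).prod P) :=
    hz.mono_measure (Measure.prod_mono
      (Measure.restrict_mono (Ioc_subset_Icc_self.trans (Icc_subset_Icc_right ht.2)) le_rfl)
      le_rfl)
  have hpath : ∀ᵐ ξ ∂P, q z (X t ξ) =
      q z (X 0 ξ) + ∫ s in 0..t, densityRate ν q f C P X s ξ z := by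
    filter_upwards [h.ode, hzt.prod_left_ae] with ξ hξ hi
    exact h.density_eq_add_integral hξ ht.1 ((intervalIntegrable_iff_integrableOn_Ioc_of_le ht.1).2 hi)
  have hprim : Integrable (fun ξ => ∫ s in 0..t, densityRate ν q f C P X s ξ z) P := by
    simp only [intervalIntegral.integral_of_le ht.1]
    exact hzt.integral_prod_right
  have hqt : Integrable (fun ξ => q z (X t ξ)) P :=
    (hq0.add hprim).congr (by filter_upwards [hpath] with ξ hξ using hξ.symm)
  have hint : Integrable (q z) (P.map (X t)) :=
    (integrable_map_measure (h.model.measurable_right z).aestronglyMeasurable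
      (h.measurable t).aemeasurable).2 hqt
  have heq : mixtureDensity q (P.map (X t)) z = mixtureDensity q (P.map (X 0)) z +
      ∫ s in 0..t, ∫ ξ, densityRate ν q f C P X s ξ z ∂P := by
    rw [h.mixtureDensity_map, h.mixtureDensity_map, integral_congr_ae hpath,
      integral_add hq0 hprim]
    simp only [intervalIntegral.integral_of_le ht.1]
    rw [integral_integral_swap (f := fun s ξ => densityRate ν q f C P X s ξ z) hzt]
  refine ⟨hint, h.model.mixtureDensity_pos (h.map_compl t) hint, ?_, heq⟩
  rw [heq]
  gcongr
  rw [intervalIntegral.integral_of_le ht.1, ← integral_prod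
    (fun p : ℝ × Ξ => densityRate ν q f C P X p.1 p.2 z) hzt]
  refine (Real.le_norm_self _).trans ((norm_integral_le_integral_norm _).trans ?_)
  refine integral_mono_measure (Measure.prod_mono
      (Measure.restrict_mono (Ioc_subset_Icc_self.trans (Icc_subset_Icc_right ht.2)) le_rfl)
      le_rfl) (ae_of_all _ fun _ => norm_nonneg _) hz.norm

omit [SigmaFinite ν] in
/-- The laws of a continuous flow over a bounded time interval put mass one half on a common
compact set. -/
theorem exists_isCompact_half_le (h : IsContinuousFlow Ω ν q f C P X) (T : ℝ)
    {K₀ : Set (Param d)} (hK₀ : IsCompact K₀) (hK₀Ω : K₀ ⊆ Ω) :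
    ∃ K, IsCompact K ∧ K ⊆ Ω ∧ K₀ ⊆ K ∧ ∀ s ∈ Icc 0 T, 1 / 2 ≤ (P.map (X s)).real K := by
  -- Each path has compact image in `Ω` over `[0, T]`, hence lies in some core. The sets `A n`
  -- therefore increase to the whole space, and one of them has probability above one half.
  let A : ℕ → Set Ξ := fun n => {ξ | ∀ s ∈ Icc 0 T, X s ξ ∈ compactCore Ω n}
  have hmono : Monotone A := fun m n hmn ξ hξ s hs => monotone_compactCore Ω hmn (hξ s hs)
  have hU : ⋃ n, A n = univ := by
    refine eq_univ_of_forall fun ξ => mem_iUnion.2 ?_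
    obtain ⟨n, hn⟩ := exists_subset_compactCore h.model.isOpen
      ((isCompact_Icc (a := (0 : ℝ)) (b := T)).image (h.continuous ξ))
      (by rintro _ ⟨s, -, rfl⟩; exact h.mem s ξ)
    exact ⟨n, fun s hs => hn ⟨s, hs, rfl⟩⟩
  have hlim := tendsto_measure_iUnion_atTop (μ := P) hmono
  rw [hU, measure_univ] at hlim
  obtain ⟨n, hn⟩ := (hlim.eventually (lt_mem_nhds
    (ENNReal.half_lt_self one_ne_zero ENNReal.one_ne_top))).exists
  refine ⟨compactCore Ω n ∪ K₀, (isCompact_compactCore Ω n).union hK₀,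
    union_subset (compactCore_subset Ω n) hK₀Ω, subset_union_right, fun s hs => ?_⟩
  have hP := h.isProbabilityMeasure_map s
  have h1 : P (A n) ≤ P.map (X s) (compactCore Ω n ∪ K₀) := by
    rw [Measure.map_apply (h.measurable s)
      ((isCompact_compactCore Ω n).union hK₀).measurableSet]
    exact measure_mono fun ξ hξ => Or.inl (hξ s hs)
  have := ENNReal.toReal_mono (measure_ne_top _ _) (hn.le.trans h1)
  simpa [Measure.real] using this

/-- Domination along the flow, uniform over bounded time intervals and compact sets. -/
theorem exists_bound (h : IsContinuousFlow Ω ν q f C P X) {T : ℝ} (hT : 0 < T)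
    {K₀ : Set (Param d)} (hK₀ : IsCompact K₀) (hK₀Ω : K₀ ⊆ Ω) :
    ∃ B : Z → ℝ, Integrable B ν ∧ ∀ᵐ z ∂ν, ∀ s ∈ Icc 0 T, ∀ l ∈ K₀,
      ‖gradient (q z) l‖ * |f z + Real.log (mixtureDensity q (P.map (X s)) z)| ≤ B z := by
  obtain ⟨K, hK, hKΩ, hsub, hhalf⟩ := h.exists_isCompact_half_le T hK₀ hK₀Ω
  obtain ⟨b, hb, -, hbd⟩ := h.model.exists_bound hK hKΩ
  obtain ⟨M, hM, hdom⟩ := h.exists_dominating hT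
  refine ⟨_, (hb.const_mul (1 + |Real.log (1 / 2)|)).add hM, ?_⟩
  filter_upwards [hdom] with z hz s hs l hl
  have hP := h.isProbabilityMeasure_map s
  obtain ⟨hint, -, hle, -⟩ := hz.2 s hs
  exact (hbd _ (h.map_compl s) (1 / 2) (by norm_num) (hhalf s hs) z hint l (hsub hl)).2.trans
    (add_le_add_right hle _)

theorem ae_continuousOn_mixtureDensity (h : IsContinuousFlow Ω ν q f C P X) {T : ℝ}
    (hT : 0 < T) :
    ∀ᵐ z ∂ν, ContinuousOn (fun s => mixtureDensity q (P.map (X s)) z) (Icc 0 T) := by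
  obtain ⟨M, -, hdom⟩ := h.exists_dominating hT
  filter_upwards [hdom] with z hz
  have hi : IntegrableOn (fun s => ∫ ξ, densityRate ν q f C P X s ξ z ∂P) (uIcc 0 T) := by
    rw [uIcc_of_le hT.le]; exact hz.1.integral_prod_left
  have hc := intervalIntegral.continuousOn_primitive_interval hi
  rw [uIcc_of_le hT.le] at hc
  exact (continuousOn_const.add hc).congr fun t ht => (hz.2 t ht).2.2.2

/-- The velocity field is jointly continuous in time and space. -/
theorem continuousOn_velocityField (h : IsContinuousFlow Ω ν q f C P X) :
    ContinuousOn (fun p : ℝ × Param d => velocityField ν q f (P.map (X p.1)) p.2)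
      (Ici 0 ×ˢ Ω) := by
  rintro ⟨s, l⟩ ⟨hs, hl⟩
  simp only [mem_Ici] at hs hl
  obtain ⟨r, hr, hsub⟩ := Metric.nhds_basis_closedBall.mem_iff.1 (h.model.isOpen.mem_nhds hl)
  have hT : 0 < s + 1 := by linarith
  obtain ⟨B, hB, hbd⟩ := h.exists_bound hT (isCompact_closedBall l r) hsub
  have hnhds : Icc 0 (s + 1) ×ˢ Metric.closedBall l r ∈ 𝓝[Ici 0 ×ˢ Ω] (s, l) := by
    rw [nhdsWithin_prod_eq]
    refine prod_mem_prod ?_ (mem_nhdsWithin_of_mem_nhds (Metric.closedBall_mem_nhds l hr))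
    refine mem_nhdsWithin.2 ⟨Iio (s + 1), isOpen_Iio, by simp, fun x hx => ⟨hx.2, hx.1.le⟩⟩
  have hprob := h.isProbabilityMeasure_map
  -- Near `(s, l)` the bound on `[0, s + 1]` times a closed ball dominates, while the integrand
  -- converges for almost every `z`.
  refine Tendsto.neg (tendsto_integral_filter_of_dominated_convergence B ?_ ?_ hB ?_)
  · filter_upwards [hnhds] with p hp
    exact (h.model.measurable_potential.smul
      (h.model.measurable_gradient (hsub hp.2))).aestronglyMeasurable
  · filter_upwards [hnhds] with p hp
    filter_upwards [hbd] with z hz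
    rw [norm_smul, mul_comm]
    exact hz p.1 hp.1 p.2 hp.2
  · obtain ⟨M, -, hdom⟩ := h.exists_dominating hT
    filter_upwards [hdom, h.ae_continuousOn_mixtureDensity hT] with z hz hc
    have hsT : s ∈ Icc 0 (s + 1) := ⟨hs, by linarith⟩
    have h1 : Tendsto (fun p : ℝ × Param d => p.1) (𝓝[Ici 0 ×ˢ Ω] (s, l))
        (𝓝[Icc 0 (s + 1)] s) :=
      tendsto_nhdsWithin_iff.2 ⟨tendsto_fst.mono_left (by rw [← nhds_prod_eq]; exact nhdsWithin_le_nhds),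
        by filter_upwards [hnhds] with p hp using hp.1⟩
    have h2 : Tendsto (fun p : ℝ × Param d => p.2) (𝓝[Ici 0 ×ˢ Ω] (s, l)) (𝓝[Ω] l) :=
      tendsto_nhdsWithin_iff.2 ⟨tendsto_snd.mono_left (by rw [← nhds_prod_eq]; exact nhdsWithin_le_nhds),
        by filter_upwards [self_mem_nhdsWithin] with p hp using hp.2⟩
    exact (((hc s hsT).tendsto.comp h1).log (hz.2 s hsT).2.1.ne').const_add (f z) |>.smul
      ((h.model.continuousOn_gradient z l hl).tendsto.comp h2)

end IsContinuousFlow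

/-! ### The energy identity. -/

theorem continuous_toEuclideanLin_apply :
    Continuous (fun p : Matrix (Fin d) (Fin d) ℝ × Param d =>
      Matrix.toEuclideanLin p.1 p.2) := by
  have h : Continuous (fun p : Matrix (Fin d) (Fin d) ℝ × Param d => p.1.mulVec p.2.ofLp) :=
    continuous_fst.matrix_mulVec ((PiLp.continuous_ofLp 2 _).comp continuous_snd)
  exact (PiLp.continuous_toLp 2 _).comp h

theorem inner_toEuclideanLin_nonneg {A : Matrix (Fin d) (Fin d) ℝ} (hA : A.PosDef)
    (u : Param d) : 0 ≤ inner ℝ u (Matrix.toEuclideanLin A u) := by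
  have h := (Matrix.isPositive_toEuclideanLin_iff.2 hA.posSemidef).2 u
  rw [real_inner_comm]
  simpa using h

namespace IsContinuousFlow

variable {Ξ : Type*} [MeasurableSpace Ξ] {Ω : Set (Param d)} {ν : Measure Z} [SigmaFinite ν]
  {q : Z → Param d → ℝ} {f : Z → ℝ} {C : Param d → Matrix (Fin d) (Fin d) ℝ}
  {P : Measure Ξ} [IsProbabilityMeasure P] {X : ℝ → Ξ → Param d}

theorem continuousOn_velocity (h : IsContinuousFlow Ω ν q f C P X) (ξ : Ξ) :
    ContinuousOn (fun s => velocityField ν q f (P.map (X s)) (X s ξ)) (Ici 0) :=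
  ContinuousOn.comp (f := fun s => (s, X s ξ))
    (g := fun p : ℝ × Param d => velocityField ν q f (P.map (X p.1)) p.2)
    h.continuousOn_velocityField (continuous_id.prodMk (h.continuous ξ)).continuousOn
    fun s hs => ⟨hs, h.mem s ξ⟩

theorem continuousOn_drift (h : IsContinuousFlow Ω ν q f C P X) (ξ : Ξ) :
    ContinuousOn (fun s => drift ν q f C P X s ξ) (Ici 0) := by
  have hC : ContinuousOn (fun s => C (X s ξ)) (Ici 0) :=
    h.continuousOn_matrix.comp (h.continuous ξ).continuousOn fun s _ => h.mem s ξ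
  exact continuous_toEuclideanLin_apply.comp_continuousOn
    (f := fun s => (C (X s ξ), velocityField ν q f (P.map (X s)) (X s ξ)))
    (hC.prodMk (h.continuousOn_velocity ξ))

theorem continuousOn_dissipation (h : IsContinuousFlow Ω ν q f C P X) (ξ : Ξ) :
    ContinuousOn (fun s => dissipationRate ν q f C P X s ξ) (Ici 0) :=
  (h.continuousOn_velocity ξ).inner (h.continuousOn_drift ξ)

theorem continuousOn_densityRate (h : IsContinuousFlow Ω ν q f C P X) (ξ : Ξ) (z : Z) :
    ContinuousOn (fun s => densityRate ν q f C P X s ξ z) (Ici 0) := by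
  have hg : ContinuousOn (fun s => gradient (q z) (X s ξ)) (Ici 0) :=
    (h.model.continuousOn_gradient z).comp (h.continuous ξ).continuousOn fun s _ => h.mem s ξ
  exact hg.inner (h.continuousOn_drift ξ)

/-- The path is fixed: over `[0, T]` its image is compact and its drift bounded, so a constant times
the domination on that image suffices. The bound is not uniform in `ξ`. -/
theorem integrable_rate_mul_potential (h : IsContinuousFlow Ω ν q f C P X) {T : ℝ} (hT : 0 < T)
    (ξ : Ξ) :
    Integrable (fun p : ℝ × Z => densityRate ν q f C P X p.1 ξ p.2 *
      (f p.2 + Real.log (mixtureDensity q (P.map (X p.1)) p.2)))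
      ((volume.restrict (Icc 0 T)).prod ν) := by
  obtain ⟨B, hB, hbd⟩ := h.exists_bound hT
    ((isCompact_Icc (a := (0 : ℝ)) (b := T)).image (h.continuous ξ))
    (by rintro _ ⟨s, -, rfl⟩; exact h.mem s ξ)
  obtain ⟨R, hR⟩ := (isCompact_Icc (a := (0 : ℝ)) (b := T)).exists_bound_of_continuousOn
    ((h.continuousOn_drift ξ).mono Icc_subset_Ici_self)
  have hmeas : Measurable (fun p : ℝ × Z => densityRate ν q f C P X p.1 ξ p.2 *
      (f p.2 + Real.log (mixtureDensity q (P.map (X p.1)) p.2))) :=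
    (h.measurable_densityRate.comp
      ((measurable_fst.prodMk measurable_const).prodMk measurable_snd)).mul h.measurable_potential
  refine ((integrable_const R).mul_prod hB).mono' hmeas.aestronglyMeasurable ?_
  filter_upwards [Measure.quasiMeasurePreserving_fst.ae (ae_restrict_mem measurableSet_Icc),
    Measure.quasiMeasurePreserving_snd.ae hbd]
  rintro ⟨s, z⟩ hs hz
  simp only at hs hz
  have h1 := hz s hs (X s ξ) ⟨s, hs, rfl⟩
  rw [norm_mul, Real.norm_eq_abs, Real.norm_eq_abs]
  calc |densityRate ν q f C P X s ξ z| * |f z + Real.log (mixtureDensity q (P.map (X s)) z)|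
      ≤ (‖gradient (q z) (X s ξ)‖ * ‖drift ν q f C P X s ξ‖) *
        |f z + Real.log (mixtureDensity q (P.map (X s)) z)| := by
        gcongr; exact abs_real_inner_le_norm _ _
    _ = ‖drift ν q f C P X s ξ‖ * (‖gradient (q z) (X s ξ)‖ *
        |f z + Real.log (mixtureDensity q (P.map (X s)) z)|) := by ring
    _ ≤ R * B z := by
        have := norm_nonneg (drift ν q f C P X s ξ)
        apply mul_le_mul (hR s hs) h1 (by positivity) (this.trans (hR s hs))

/-- The drift does not depend on `z` and leaves the integral; what remains is `-v`. Here the motion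
being a gradient flow of `L` enters. -/
theorem integral_rate_mul_potential (h : IsContinuousFlow Ω ν q f C P X) (s : ℝ) (ξ : Ξ) :
    ∫ z, densityRate ν q f C P X s ξ z *
      (f z + Real.log (mixtureDensity q (P.map (X s)) z)) ∂ν =
    -dissipationRate ν q f C P X s ξ := by
  have hP := h.isProbabilityMeasure_map s
  have hi := h.model.integrable_potential_smul_gradient (h.map_compl s) (h.mem s ξ)
  rw [dissipationRate, velocityField, inner_neg_left, neg_neg, real_inner_comm, ← integral_inner hi]
  refine integral_congr_ae (ae_of_all _ fun z => ?_)
  simp only [densityRate, real_inner_smul_right]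
  rw [real_inner_comm, mul_comm]

theorem measurable_meanRate (h : IsContinuousFlow Ω ν q f C P X) :
    Measurable (fun p : Z × ℝ => ∫ ξ, densityRate ν q f C P X p.2 ξ p.1 ∂P) := by
  have hm : Measurable (fun p : (Z × ℝ) × Ξ => densityRate ν q f C P X p.1.2 p.2 p.1.1) :=
    Measurable.comp (f := fun p : (Z × ℝ) × Ξ => ((p.1.2, p.2), p.1.1))
      (g := fun p : (ℝ × Ξ) × Z => densityRate ν q f C P X p.1.1 p.1.2 p.2)
      h.measurable_densityRate
      ((measurable_fst.snd.prodMk measurable_snd).prodMk measurable_fst.fst)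
  exact (hm.stronglyMeasurable.integral_prod_right' (ν := P)).measurable

theorem measurable_transfer (h : IsContinuousFlow Ω ν q f C P X) :
    Measurable (fun p : Ξ × Z × ℝ => transferRate ν q f C P X p.2.2 p.1 p.2.1) := by
  have h1 : Measurable (fun p : Ξ × Z × ℝ => q p.2.1 (X p.2.2 p.1)) :=
    Measurable.comp (f := fun p : Ξ × Z × ℝ => ((p.2.2, p.1), p.2.1))
      (g := fun p : (ℝ × Ξ) × Z => q p.2 (X p.1.1 p.1.2)) h.measurable_density
      ((measurable_snd.snd.prodMk measurable_fst).prodMk measurable_snd.fst)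
  have h2 : Measurable (fun p : Ξ × Z × ℝ => mixtureDensity q (P.map (X p.2.2)) p.2.1) :=
    Measurable.comp (f := fun p : Ξ × Z × ℝ => (p.2.2, p.2.1))
      (g := fun p : ℝ × Z => mixtureDensity q (P.map (X p.1)) p.2) h.measurable_mixtureDensity
      (measurable_snd.snd.prodMk measurable_snd.fst)
  exact h1.mul ((h.measurable_meanRate.comp measurable_snd).div h2)

omit [SigmaFinite ν] [IsProbabilityMeasure P] in
-- Averaging `q z (X s ξ)` over `ξ` gives the mixture density, which cancels the denominator and
-- leaves the modulus of the mean rate.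
theorem lintegral_transferRate_le (h : IsContinuousFlow Ω ν q f C P X) {s : ℝ} {z : Z}
    (hint : Integrable (q z) (P.map (X s))) (hpos : 0 < mixtureDensity q (P.map (X s)) z) :
    ∫⁻ ξ, ‖transferRate ν q f C P X s ξ z‖ₑ ∂P ≤
      ∫⁻ ξ, ‖densityRate ν q f C P X s ξ z‖ₑ ∂P := by
  have hq : Integrable (fun ξ => q z (X s ξ)) P :=
    (integrable_map_measure (h.model.measurable_right z).aestronglyMeasurable
      (h.measurable s).aemeasurable).1 hint
  have hmq : Measurable (fun ξ => ‖q z (X s ξ)‖ₑ) :=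
    ((h.model.measurable_right z).comp (h.measurable s)).enorm
  have h1 : ∫⁻ ξ, ‖q z (X s ξ)‖ₑ ∂P = ‖mixtureDensity q (P.map (X s)) z‖ₑ := by
    rw [Real.enorm_of_nonneg hpos.le, h.mixtureDensity_map, ofReal_integral_eq_lintegral_ofReal hq
      (ae_of_all _ fun ξ => (h.model.pos z _ (h.mem s ξ)).le)]
    exact lintegral_congr fun ξ => Real.enorm_of_nonneg (h.model.pos z _ (h.mem s ξ)).le
  simp only [transferRate, enorm_mul]
  rw [lintegral_mul_const _ hmq, h1, ← enorm_mul, mul_div_cancel₀ _ hpos.ne']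
  exact enorm_integral_le_lintegral_enorm _

/-- The exchange term of the entropy balance along one path is integrable, because its mean modulus
is at most the total variation of the mixture density. -/
theorem integrable_transfer (h : IsContinuousFlow Ω ν q f C P X) {T : ℝ} (hT : 0 < T) :
    Integrable (fun p : Ξ × Z × ℝ => transferRate ν q f C P X p.2.2 p.1 p.2.1)
      (P.prod (ν.prod (volume.restrict (Icc 0 T)))) := by
  obtain ⟨M, -, hdom⟩ := h.exists_dominating hT
  have hmJ : Measurable (fun p : (ℝ × Ξ) × Z =>
    ‖densityRate ν q f C P X p.1.1 p.1.2 p.2‖ₑ) := h.measurable_densityRate.enorm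
  have hm : Measurable (fun p : Ξ × Z × ℝ => ‖transferRate ν q f C P X p.2.2 p.1 p.2.1‖ₑ) :=
    h.measurable_transfer.enorm
  have hm' : Measurable (fun p : Z × ℝ => ∫⁻ ξ, ‖transferRate ν q f C P X p.2 ξ p.1‖ₑ ∂P) :=
    hm.lintegral_prod_left' (μ := P)
  have hmz : ∀ z, Measurable (fun p : ℝ × Ξ => ‖densityRate ν q f C P X p.1 p.2 z‖ₑ) := fun z =>
    Measurable.comp (f := fun p : ℝ × Ξ => (p, z))
      (g := fun p : (ℝ × Ξ) × Z => ‖densityRate ν q f C P X p.1.1 p.1.2 p.2‖ₑ) hmJ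
      (measurable_id.prodMk measurable_const)
  have hJ : ∫⁻ z, ∫⁻ s in Icc 0 T, ∫⁻ ξ, ‖densityRate ν q f C P X s ξ z‖ₑ ∂P ∂volume ∂ν < ⊤ := by
    have h2 := (h.integrable_densityRate hT).2
    rw [HasFiniteIntegral, lintegral_prod_symm _ hmJ.aemeasurable] at h2
    refine lt_of_eq_of_lt (lintegral_congr fun z => ?_) h2
    exact (lintegral_prod _ (hmz z).aemeasurable).symm
  refine ⟨h.measurable_transfer.aestronglyMeasurable, ?_⟩
  rw [HasFiniteIntegral, lintegral_prod_symm _ hm.aemeasurable,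
    lintegral_prod _ hm'.aemeasurable]
  refine lt_of_le_of_lt (lintegral_mono_ae ?_) hJ
  filter_upwards [hdom] with z hz
  refine lintegral_mono_ae ?_
  filter_upwards [ae_restrict_mem measurableSet_Icc] with s hs
  exact h.lintegral_transferRate_le (hz.2 s hs).1 (hz.2 s hs).2.1

/-- Conservation of mass: after averaging over `ξ`, the time integral is the increment of the
mixture density over `[0, T]`, and both endpoints have mass one. -/
theorem integral_transfer (h : IsContinuousFlow Ω ν q f C P X) {T : ℝ} (hT : 0 < T) :
    ∫ ξ, ∫ p, transferRate ν q f C P X p.2 ξ p.1 ∂(ν.prod (volume.restrict (Icc 0 T))) ∂P = 0 := by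
  obtain ⟨M, -, hdom⟩ := h.exists_dominating hT
  have hR := h.integrable_transfer hT
  have hP := h.isProbabilityMeasure_map
  rw [integral_integral_swap hR, integral_prod _ hR.integral_prod_right]
  have hz : ∀ᵐ z ∂ν, (∫ s in Icc 0 T, ∫ ξ, transferRate ν q f C P X s ξ z ∂P) =
      mixtureDensity q (P.map (X T)) z - mixtureDensity q (P.map (X 0)) z := by
    filter_upwards [hdom] with z hz
    rw [(hz.2 T ⟨hT.le, le_rfl⟩).2.2.2, add_sub_cancel_left,
      intervalIntegral.integral_of_le hT.le, ← integral_Icc_eq_integral_Ioc]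
    refine setIntegral_congr_fun measurableSet_Icc fun s hs => ?_
    simp only [transferRate, integral_mul_const]
    rw [← h.mixtureDensity_map, mul_div_cancel₀ _ (hz.2 s hs).2.1.ne']
  rw [integral_congr_ae hz, integral_sub (h.model.integrable_mixtureDensity (h.map_compl T))
    (h.model.integrable_mixtureDensity (h.map_compl 0)),
    h.model.integral_mixtureDensity (h.map_compl T),
    h.model.integral_mixtureDensity (h.map_compl 0), sub_self]

/-- The entropy balance along almost every path. -/
theorem ae_integral_dissipation_eq (h : IsContinuousFlow Ω ν q f C P X) {T : ℝ} (hT : 0 < T) :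
    ∀ᵐ ξ ∂P, ∫ s in Icc 0 T, dissipationRate ν q f C P X s ξ =
      (∫ z, q z (X 0 ξ) * (f z + Real.log (mixtureDensity q (P.map (X 0)) z)) ∂ν) -
      (∫ z, q z (X T ξ) * (f z + Real.log (mixtureDensity q (P.map (X T)) z)) ∂ν) +
      ∫ p, transferRate ν q f C P X p.2 ξ p.1 ∂(ν.prod (volume.restrict (Icc 0 T))) := by
  obtain ⟨M, -, hdom⟩ := h.exists_dominating hT
  have hP := h.isProbabilityMeasure_map
  filter_upwards [h.ode, (h.integrable_transfer hT).prod_right_ae] with ξ hξ hR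
  have hJh := h.integrable_rate_mul_potential hT ξ
  have hparts : ∀ᵐ z ∂ν, (∫ s in Icc 0 T, densityRate ν q f C P X s ξ z *
        (f z + Real.log (mixtureDensity q (P.map (X s)) z))) +
      (∫ s in Icc 0 T, transferRate ν q f C P X s ξ z) =
      q z (X T ξ) * (f z + Real.log (mixtureDensity q (P.map (X T)) z)) -
      q z (X 0 ξ) * (f z + Real.log (mixtureDensity q (P.map (X 0)) z)) := by
    filter_upwards [hdom, hJh.prod_left_ae, hR.prod_right_ae] with z hz h1 h2
    rw [← integral_add h1 h2, integral_Icc_eq_integral_Ioc,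
      ← intervalIntegral.integral_of_le hT.le]
    have hJint : ∀ t ∈ Icc 0 T,
        IntervalIntegrable (fun s => densityRate ν q f C P X s ξ z) volume 0 t := fun t ht =>
      ((h.continuousOn_densityRate ξ z).mono (by
        rw [uIcc_of_le ht.1]; exact Icc_subset_Ici_self)).intervalIntegrable
    have hg : IntervalIntegrable (fun s => ∫ ξ', densityRate ν q f C P X s ξ' z ∂P)
        volume 0 T := by
      rw [intervalIntegrable_iff_integrableOn_Icc_of_le hT.le]
      exact hz.1.integral_prod_left
    -- Here `z` and `ξ` are fixed, and the additive constant beside the logarithm is `f z`.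
    exact integral_mul_log_by_parts (φ := fun s => q z (X s ξ))
      (F := fun s => mixtureDensity q (P.map (X s)) z) hT.le hg (hJint T ⟨hT.le, le_rfl⟩)
      (fun t ht => (hz.2 t ht).2.2.2)
      (fun t ht => h.density_eq_add_integral hξ ht.1 (hJint t ht))
      (fun t ht => (hz.2 t ht).2.1)
  have hsum := integral_congr_ae hparts
  rw [integral_add hJh.integral_prod_right hR.integral_prod_left,
    integral_sub (h.model.integrable_mul_potential (h.map_compl T) (h.mem T ξ))
      (h.model.integrable_mul_potential (h.map_compl 0) (h.mem 0 ξ)),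
    ← integral_integral_swap hJh] at hsum
  rw [integral_prod _ hR]
  simp only [h.integral_rate_mul_potential, integral_neg] at hsum
  linarith

/-- The energy identity: the dissipation over `[0, T]` is the decrease of the negated ELBO. -/
theorem lintegral_dissipation (h : IsContinuousFlow Ω ν q f C P X) {T : ℝ} (hT : 0 < T) :
    ∫⁻ s in Icc 0 T, ∫⁻ ξ, ENNReal.ofReal
        (dissipationRate ν q f C P X s ξ) ∂P =
      ENNReal.ofReal (negELBO ν q f (P.map (X 0)) - negELBO ν q f (P.map (X T))) := by
  have hm : Measurable (fun p : ℝ × Ξ =>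
      dissipationRate ν q f C P X p.1 p.2) :=
    h.measurable_velocity.inner h.measurable_drift
  have hnn : ∀ s ξ, 0 ≤ dissipationRate ν q f C P X s ξ := fun s ξ =>
    inner_toEuclideanLin_nonneg (h.posDef _ (h.mem s ξ)) _
  have hV : ∀ s, 0 ≤ s → Integrable (fun ξ => ∫ z, q z (X s ξ) *
      (f z + Real.log (mixtureDensity q (P.map (X s)) z)) ∂ν) P ∧
      ∫ ξ, ∫ z, q z (X s ξ) * (f z + Real.log (mixtureDensity q (P.map (X s)) z)) ∂ν ∂P =
        negELBO ν q f (P.map (X s)) := by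
    intro s hs
    have hi := (h.mem_finiteLaws s hs).2.2.integral_prod_left
    refine ⟨(integrable_map_measure hi.aestronglyMeasurable (h.measurable s).aemeasurable).1 hi, ?_⟩
    rw [negELBO, integral_map (h.measurable s).aemeasurable hi.aestronglyMeasurable]
  have hbal := h.ae_integral_dissipation_eq hT
  have hR := (h.integrable_transfer hT).integral_prod_left
  -- No direct estimate of the dissipation is used: the balance writes its time integral as a
  -- combination of three functions integrable in `ξ`.
  have hint : Integrable (fun ξ => ∫ s in Icc 0 T,
      dissipationRate ν q f C P X s ξ) P :=
    (((hV 0 le_rfl).1.sub (hV T hT.le).1).add hR).congr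
      (by filter_upwards [hbal] with ξ hξ using hξ.symm)
  rw [lintegral_lintegral_swap hm.ennreal_ofReal.aemeasurable]
  calc ∫⁻ ξ, (∫⁻ s in Icc 0 T, ENNReal.ofReal (dissipationRate ν q f C P X s ξ)) ∂P
      = ∫⁻ ξ, ENNReal.ofReal (∫ s in Icc 0 T, dissipationRate ν q f C P X s ξ) ∂P := by
        refine lintegral_congr fun ξ => ?_
        refine (ofReal_integral_eq_lintegral_ofReal ?_ (ae_of_all _ fun s => hnn s ξ)).symm
        exact ((h.continuousOn_dissipation ξ).mono Icc_subset_Ici_self).integrableOn_compact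
          isCompact_Icc
    _ = ENNReal.ofReal (∫ ξ, (∫ s in Icc 0 T, dissipationRate ν q f C P X s ξ) ∂P) :=
        (ofReal_integral_eq_lintegral_ofReal hint
          (ae_of_all _ fun ξ => integral_nonneg fun s => hnn s ξ)).symm
    _ = _ := by
        rw [integral_congr_ae hbal]
        refine congrArg _ ((integral_add ((hV 0 le_rfl).1.sub (hV T hT.le).1) hR).trans ?_)
        refine (congrArg₂ _ (integral_sub (hV 0 le_rfl).1 (hV T hT.le).1)
          (h.integral_transfer hT)).trans ?_
        rw [(hV 0 le_rfl).2, (hV T hT.le).2, add_zero]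

/-- The dissipation rate attains its minimum on every bounded time interval. -/
theorem exists_isMinOn_dissipation (h : IsContinuousFlow Ω ν q f C P X) {T : ℝ} (hT : 0 ≤ T) :
    ∃ s ∈ Icc 0 T, IsMinOn (fun s => ∫⁻ ξ, ENNReal.ofReal
      (dissipationRate ν q f C P X s ξ) ∂P)
      (Icc 0 T) s := by
  have hm : Measurable (fun p : ℝ × Ξ =>
      dissipationRate ν q f C P X p.1 p.2) :=
    h.measurable_velocity.inner h.measurable_drift
  refine LowerSemicontinuousOn.exists_isMinOn ⟨0, le_rfl, hT⟩ isCompact_Icc ?_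
  rw [lowerSemicontinuousOn_iff_le_liminf]
  intro s hs
  -- Fatou: for each `ξ` the rate is continuous in time, so its mean, possibly infinite, is lower
  -- semicontinuous.
  refine le_trans (lintegral_mono fun ξ => ?_) (lintegral_liminf_le'
    fun r => ((hm.comp (measurable_const.prodMk measurable_id)).ennreal_ofReal).aemeasurable)
  have hc := ((h.continuousOn_dissipation ξ).mono Icc_subset_Ici_self) s hs
  have : (𝓝[Icc 0 T] s).NeBot := mem_closure_iff_nhdsWithin_neBot.1 (subset_closure hs)
  exact ((ENNReal.continuous_ofReal.tendsto _).comp hc.tendsto).liminf_eq.ge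

end IsContinuousFlow

/-! ### From the random particle to its laws. -/

/-- The usual change of variables wants `F` measurable everywhere, whereas the integrands built from
`C` and the gradient of `q` are controlled only on `Ω`. -/
theorem lintegral_map_of_measurable_subtype {α β : Type*} [MeasurableSpace α] [MeasurableSpace β]
    {μ : Measure α} {s : Set β} (hs : MeasurableSet s) {Y : α → β} (hY : Measurable Y)
    (hmem : ∀ a, Y a ∈ s) {F : β → ENNReal} (hF : Measurable fun b : s => F b) :
    ∫⁻ b, F b ∂(μ.map Y) = ∫⁻ a, F (Y a) ∂μ := by
  have hY' : Measurable (fun a => (⟨Y a, hmem a⟩ : s)) := hY.subtype_mk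
  have h : μ.map Y = (μ.map fun a => (⟨Y a, hmem a⟩ : s)).map Subtype.val :=
    (Measure.map_map measurable_subtype_coe hY').symm
  rw [h, (MeasurableEmbedding.subtype_coe hs).lintegral_map, lintegral_map hF hY']

namespace IsPreconditionedFlow

variable {Ξ : Type*} [MeasurableSpace Ξ] {Ω : Set (Param d)} {ν : Measure Z} [SigmaFinite ν]
  {q : Z → Param d → ℝ} {f : Z → ℝ} {C : Param d → Matrix (Fin d) (Fin d) ℝ}
  {P : Measure Ξ} [IsProbabilityMeasure P] {Λ : ℝ → Ξ → Param d}
  {ρ : ℝ → Measure (Param d)} {v : ℝ → Param d → Param d}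

omit [IsProbabilityMeasure P] in
theorem velocity_eq (hflow : IsPreconditionedFlow Ω ν q f C P Λ ρ v)
    (hM : IsRegularModel Ω ν q f) {t : ℝ} (ht : 0 ≤ t) {l : Param d} (hl : l ∈ Ω) :
    v t l = velocityField ν q f (ρ t) l := by
  obtain ⟨δ, hδ, hg⟩ := hflow.velocity t ht
  rw [velocityField, ← hM.gradient_firstVariation_eq hδ hl (hg l hl), neg_neg]

omit [SigmaFinite ν] [IsProbabilityMeasure P] in
theorem mem_finiteLaws (hflow : IsPreconditionedFlow Ω ν q f C P Λ ρ v) {t : ℝ} (ht : 0 ≤ t) :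
    ρ t ∈ finiteLaws Ω ν q f := by
  obtain ⟨δ, hδ, -⟩ := hflow.velocity t ht
  exact hδ.1

/-- Off a null set, the paths of the flow are continuous curves in `Ω`; on it they can be replaced
by constants. -/
theorem exists_isContinuousFlow (hflow : IsPreconditionedFlow Ω ν q f C P Λ ρ v)
    (hM : IsRegularModel Ω ν q f) (hCcont : ContinuousOn C Ω) (hCpos : ∀ l ∈ Ω, (C l).PosDef)
    (hfinite : ∀ T : ℝ, 0 < T →
      ∫⁻ t in Icc 0 T, ∫⁻ l, ∫⁻ z,
        ‖inner ℝ (gradient (q z) l) (Matrix.toEuclideanLin (C l) (v t l))‖ₑ ∂ν ∂(ρ t) < ⊤) :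
    ∃ X : ℝ → Ξ → Param d, IsContinuousFlow Ω ν q f C P X ∧
      ∀ t, 0 ≤ t → P.map (X t) = ρ t := by
  have hgood := hflow.mem.and hflow.ode
  obtain ⟨ξ₀, hξ₀, -⟩ := hgood.exists
  -- The bad set need not be measurable; enlarging it to a measurable null set keeps the modified
  -- particle measurable.
  obtain ⟨N, hbad, hN, hN0⟩ := exists_measurable_superset_of_null (ae_iff.1 hgood)
  have hgoodN : ∀ ξ ∉ N, (∀ t, 0 ≤ t → Λ t ξ ∈ Ω) ∧ ∀ t, 0 ≤ t →
      HasDerivWithinAt (fun s => Λ s ξ)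
        (Matrix.toEuclideanLin (C (Λ t ξ)) (v t (Λ t ξ))) (Ici 0) t := fun ξ hξ => by
    by_contra hcon
    exact hξ (hbad hcon)
  have hNae : ∀ᵐ ξ ∂P, ξ ∉ N := measure_eq_zero_iff_ae_notMem.1 hN0
  classical
  -- `max s 0` freezes the path at negative times, making it continuous on the whole line; `Λ 0 ξ₀`
  -- is any point of `Ω` reached by a good path.
  let X : ℝ → Ξ → Param d := fun s ξ => if ξ ∈ N then Λ 0 ξ₀ else Λ (max s 0) ξ
  have hXmeas : ∀ s, Measurable (X s) := fun s =>
    Measurable.ite hN measurable_const (hflow.measurable _ (le_max_right _ _))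
  have hXmem : ∀ s ξ, X s ξ ∈ Ω := by
    intro s ξ
    by_cases hξ : ξ ∈ N
    · simpa [X, hξ] using hξ₀ 0 le_rfl
    · simpa [X, hξ] using (hgoodN ξ hξ).1 _ (le_max_right _ _)
  have hXΛ : ∀ ξ ∉ N, ∀ s, 0 ≤ s → X s ξ = Λ s ξ := by
    intro ξ hξ s hs
    simp [X, hξ, max_eq_left hs]
  have hXlaw : ∀ t, 0 ≤ t → P.map (X t) = ρ t := by
    intro t ht
    rw [hflow.law t ht]
    exact Measure.map_congr (by filter_upwards [hNae] with ξ hξ using hXΛ ξ hξ t ht)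
  refine ⟨X, ⟨hM, hCcont, hCpos, hXmeas, ?_, hXmem, ?_, ?_, ?_⟩, hXlaw⟩
  · intro ξ
    by_cases hξ : ξ ∈ N
    · simpa [X, hξ] using continuous_const
    · have hc : ContinuousOn (fun s => Λ s ξ) (Ici 0) := fun s hs =>
        ((hgoodN ξ hξ).2 s hs).continuousWithinAt
      have := hc.comp_continuous (continuous_id.max continuous_const)
        (fun s => le_max_right s (0 : ℝ))
      simp only [X, hξ, if_false]
      exact this
  · intro s hs
    rw [hXlaw s hs]
    exact hflow.mem_finiteLaws hs
  · filter_upwards [hNae] with ξ hξ s hs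
    have h := (hgoodN ξ hξ).2 s hs
    rw [hflow.velocity_eq hM hs ((hgoodN ξ hξ).1 s hs), ← hXΛ ξ hξ s hs] at h
    rw [drift, hXlaw s hs]
    exact h.congr (fun r hr => hXΛ ξ hξ r hr) (hXΛ ξ hξ s hs)
  · intro T hT
    refine lt_of_eq_of_lt ?_ (hfinite T hT)
    refine setLIntegral_congr_fun measurableSet_Icc fun t ht => ?_
    have hp : IsProbabilityMeasure (ρ t) := (hflow.mem_finiteLaws ht.1).1
    have hae : ∀ᵐ l ∂(ρ t), l ∈ Ω := mem_ae_iff.2 (hflow.mem_finiteLaws ht.1).2.1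
    have hsub : Measurable (fun p : Ω × Z => ‖inner ℝ (gradient (q p.2) (p.1 : Param d))
        (Matrix.toEuclideanLin (C p.1) (velocityField ν q f (ρ t) p.1))‖ₑ) :=
      ((hM.measurable_gradient_comp measurable_subtype_coe (fun l : Ω => l.2)).inner
        ((measurable_toEuclideanLin_comp hCcont measurable_subtype_coe (fun l : Ω => l.2)
          (hM.measurable_velocityField_comp measurable_subtype_coe
            (fun l : Ω => l.2))).comp measurable_fst)).enorm
    have h1 : ∫⁻ l, ∫⁻ z,
        ‖inner ℝ (gradient (q z) l) (Matrix.toEuclideanLin (C l) (v t l))‖ₑ ∂ν ∂(ρ t) =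
        ∫⁻ l, ∫⁻ z, ‖inner ℝ (gradient (q z) l)
          (Matrix.toEuclideanLin (C l) (velocityField ν q f (ρ t) l))‖ₑ ∂ν ∂(ρ t) := by
      refine lintegral_congr_ae ?_
      filter_upwards [hae] with l hl
      rw [hflow.velocity_eq hM ht.1 hl]
    simp only [densityRate, drift]
    rw [h1, hXlaw t ht.1]
    have h2 := lintegral_map_of_measurable_subtype hM.isOpen.measurableSet (hXmeas t) (hXmem t)
      (F := fun l => ∫⁻ z, ‖inner ℝ (gradient (q z) l)
          (Matrix.toEuclideanLin (C l) (velocityField ν q f (ρ t) l))‖ₑ ∂ν)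
      (μ := P) (hsub.lintegral_prod_right' (ν := ν))
    rw [hXlaw t ht.1] at h2
    exact h2.symm

omit [IsProbabilityMeasure P] in
theorem weightedSqNorm_eq (hflow : IsPreconditionedFlow Ω ν q f C P Λ ρ v)
    {X : ℝ → Ξ → Param d} (hX : IsContinuousFlow Ω ν q f C P X) {t : ℝ} (ht : 0 ≤ t)
    (hlaw : P.map (X t) = ρ t) :
    weightedSqNorm C (ρ t) (v t) = ∫⁻ ξ, ENNReal.ofReal (dissipationRate ν q f C P X t ξ) ∂P := by
  have hM := hX.model
  have hp : IsProbabilityMeasure (ρ t) := (hflow.mem_finiteLaws ht).1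
  have hae : ∀ᵐ l ∂(ρ t), l ∈ Ω := mem_ae_iff.2 (hflow.mem_finiteLaws ht).2.1
  have hvel : Measurable (fun l : Ω => velocityField ν q f (ρ t) l) :=
    hM.measurable_velocityField_comp measurable_subtype_coe fun l : Ω => l.2
  have hsub : Measurable (fun l : Ω => ENNReal.ofReal (inner ℝ (velocityField ν q f (ρ t) l)
      (Matrix.toEuclideanLin (C l) (velocityField ν q f (ρ t) l)))) :=
    (hvel.inner (measurable_toEuclideanLin_comp hX.continuousOn_matrix measurable_subtype_coe
      (fun l : Ω => l.2) hvel)).ennreal_ofReal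
  have h1 : weightedSqNorm C (ρ t) (v t) =
      ∫⁻ l, ENNReal.ofReal (inner ℝ (velocityField ν q f (ρ t) l)
        (Matrix.toEuclideanLin (C l) (velocityField ν q f (ρ t) l))) ∂(P.map (X t)) := by
    rw [hlaw]
    refine lintegral_congr_ae ?_
    filter_upwards [hae] with l hl
    rw [hflow.velocity_eq hM ht hl]
  rw [h1, lintegral_map_of_measurable_subtype (s := Ω) (F := fun l => ENNReal.ofReal
    (inner ℝ (velocityField ν q f (ρ t) l)
      (Matrix.toEuclideanLin (C l) (velocityField ν q f (ρ t) l))))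
    hM.isOpen.measurableSet (hX.measurable t) (hX.mem t) hsub]
  simp only [dissipationRate, drift, hlaw]

end IsPreconditionedFlow

end

/-! ### Lower bound, minimum and rate. -/

theorem mainTheorem3 {d : ℕ} {Z Ξ : Type*} [MeasurableSpace Z] [MeasurableSpace Ξ]
    (Ω : Set (Param d)) (ν : Measure Z) [SigmaFinite ν]
    (q : Z → Param d → ℝ) (f : Z → ℝ) (hmodel : IsRegularModel Ω ν q f)
    (C : Param d → Matrix (Fin d) (Fin d) ℝ)
    (hCcont : ContinuousOn C Ω) (hCpos : ∀ l ∈ Ω, (C l).PosDef)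
    (P : Measure Ξ) [IsProbabilityMeasure P] (Λ : ℝ → Ξ → Param d)
    (ρ : ℝ → Measure (Param d)) (v : ℝ → Param d → Param d)
    (hflow : IsPreconditionedFlow Ω ν q f C P Λ ρ v)
    (hfinite : ∀ T : ℝ, 0 < T →
      ∫⁻ t in Icc 0 T, ∫⁻ l, ∫⁻ z,
        ‖inner ℝ (gradient (q z) l) (Matrix.toEuclideanLin (C l) (v t l))‖ₑ ∂ν ∂(ρ t) < ⊤) :
    BddBelow (negELBO ν q f '' finiteLaws Ω ν q f) ∧
    (∀ t : ℝ, 0 < t →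
      (∃ s ∈ Icc (0 : ℝ) t,
        IsMinOn (fun r => weightedSqNorm C (ρ r) (v r)) (Icc 0 t) s ∧
        weightedSqNorm C (ρ s) (v s) ≤
          (∫⁻ r in Icc 0 t, weightedSqNorm C (ρ r) (v r)) / ENNReal.ofReal t) ∧
      (∫⁻ r in Icc 0 t, weightedSqNorm C (ρ r) (v r)) / ENNReal.ofReal t ≤
        ENNReal.ofReal
          ((negELBO ν q f (ρ 0) - sInf (negELBO ν q f '' finiteLaws Ω ν q f)) / t)) ∧
    Tendsto (fun t : ℝ => ⨅ s ∈ Icc (0 : ℝ) t, weightedSqNorm C (ρ s) (v s)) atTop (𝓝 0) := by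
  obtain ⟨X, hX, hlaw⟩ := hflow.exists_isContinuousFlow hmodel hCcont hCpos hfinite
  have hbdd : BddBelow (negELBO ν q f '' finiteLaws Ω ν q f) := by
    refine ⟨1 - ∫ z, Real.exp (-f z) ∂ν, ?_⟩
    rintro _ ⟨σ, hσ, rfl⟩
    exact hmodel.one_sub_evidence_le_negELBO hσ
  have hW : ∀ s, 0 ≤ s → weightedSqNorm C (ρ s) (v s) =
      ∫⁻ ξ, ENNReal.ofReal (dissipationRate ν q f C P X s ξ) ∂P := fun s hs =>
    hflow.weightedSqNorm_eq hX hs (hlaw s hs)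
  have hmain : ∀ t : ℝ, 0 < t →
      (∃ s ∈ Icc (0 : ℝ) t,
        IsMinOn (fun r => weightedSqNorm C (ρ r) (v r)) (Icc 0 t) s ∧
        weightedSqNorm C (ρ s) (v s) ≤
          (∫⁻ r in Icc 0 t, weightedSqNorm C (ρ r) (v r)) / ENNReal.ofReal t) ∧
      (∫⁻ r in Icc 0 t, weightedSqNorm C (ρ r) (v r)) / ENNReal.ofReal t ≤
        ENNReal.ofReal
          ((negELBO ν q f (ρ 0) - sInf (negELBO ν q f '' finiteLaws Ω ν q f)) / t) := by
    intro t ht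
    constructor
    · obtain ⟨s, hs, hmin⟩ := hX.exists_isMinOn_dissipation ht.le
      have hmin' : IsMinOn (fun r => weightedSqNorm C (ρ r) (v r)) (Icc 0 t) s := by
        intro r hr
        have := hmin hr
        simp only [mem_ofPred_eq] at this ⊢
        rwa [hW s hs.1, hW r hr.1]
      refine ⟨s, hs, hmin', ?_⟩
      rw [ENNReal.le_div_iff_mul_le (Or.inl (by simpa using ht)) (Or.inl ENNReal.ofReal_ne_top)]
      calc weightedSqNorm C (ρ s) (v s) * ENNReal.ofReal t
          = ∫⁻ _ in Icc 0 t, weightedSqNorm C (ρ s) (v s) := by simp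
        _ ≤ ∫⁻ r in Icc 0 t, weightedSqNorm C (ρ r) (v r) :=
            setLIntegral_mono' measurableSet_Icc fun r hr => hmin' hr
    -- The energy identity turns the mean into `(L(ρ_0) - L(ρ_t)) / t`, and `L(ρ_t)` is at least the
    -- infimum.
    · rw [setLIntegral_congr_fun measurableSet_Icc fun s hs => hW s hs.1,
        hX.lintegral_dissipation ht, hlaw 0 le_rfl, hlaw t ht.le, ← ENNReal.ofReal_div_of_pos ht]
      refine ENNReal.ofReal_le_ofReal (div_le_div_of_nonneg_right ?_ ht.le)
      have := csInf_le hbdd (mem_image_of_mem _ (hflow.mem_finiteLaws ht.le))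
      linarith
  refine ⟨hbdd, hmain, ?_⟩
  have hlim : Tendsto (fun t : ℝ => ENNReal.ofReal
      ((negELBO ν q f (ρ 0) - sInf (negELBO ν q f '' finiteLaws Ω ν q f)) / t)) atTop (𝓝 0) := by
    have h := ENNReal.tendsto_ofReal (tendsto_const_nhds (x := negELBO ν q f (ρ 0) -
      sInf (negELBO ν q f '' finiteLaws Ω ν q f)).div_atTop tendsto_id)
    simpa using h
  refine tendsto_of_tendsto_of_tendsto_of_le_of_le' tendsto_const_nhds hlim
    (Eventually.of_forall fun _ => zero_le) ?_
  filter_upwards [eventually_gt_atTop 0] with t ht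
  obtain ⟨⟨s, hs, -, hle⟩, hle'⟩ := hmain t ht
  exact (iInf₂_le s hs).trans (hle.trans hle')
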